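/- Let $\Gamma$ be a finite subgroup of $\mathbb{C}^*$, of order $n$. For a finite commutative group $G$, let $\mathbf{X}_G=\{x_\sigma : \sigma\in G\cup\{0\}\}$ be an alphabet of non-commuting variables, and let $\Delta$ be the continuous coproduct on $\mathbb{C}\langle\langle \mathbf{X}_G\rangle\rangle$ for which all $x_\sigma$ are primitive, $\Delta x_\sigma = x_\sigma\otimes 1+1\otimes x_\sigma$. A series $F$ is group-like if its constant term is $1$ and $\Delta F = F\otimes F$. Put $\omega_0=dt/t$ and $\omega_\sigma = dt/(\sigma^{-1}-t)$ for $\sigma\in\Gamma$, and, for $0<a<b<1$ and $a_1,\dots,a_p\in\Gamma\cup\{0\}$, $$I_{[a,b]}(a_1,\dots,a_p)=\int_a^b\omega_{a_1}(t_1)\int_a^{t_1}\omega_{a_2}(t_2)\cdots\int_a^{t_{p-1}}\omega_{a_p}(t_p)$$ (equal to $1$ for $p=0$). There is exactly one group-like series $\mathcal{I}\in\mathbb{C}\langle\langle\mathbf{X}_\Gamma\rangle\rangle$ (the regularised series) whose coefficients at $x_0$ and $x_1$ are zero and whose coefficient at each word $x_{a_1}\cdots x_{a_p}$ that does not begin with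 $x_1$ and does not end with $x_0$ is $\lim_{a\to0^+,\,b\to1^-} I_{[a,b]}(a_1,\dots,a_p)$. For a morphism $\phi:G\to G'$ of finite commutative groups let $\phi_*:\mathbb{C}\langle\langle\mathbf{X}_{G}\rangle\rangle\to\mathbb{C}\langle\langle\mathbf{X}_{G'}\rangle\rangle$ and $\phi^*:\mathbb{C}\langle\langle\mathbf{X}_{G'}\rangle\rangle\to\mathbb{C}\langle\langle\mathbf{X}_{G}\rangle\rangle$ be the continuous algebra morphisms with $$\phi_*(x_0)=|\ker\phi|\,x_0,\quad \phi_*(x_\sigma)=x_{\phi(\sigma)}\ (\sigma\in G);\qquad \phi^*(x_0)=x_0,\quad \phi^*(x_\sigma)=\sum_{\tau\in\phi^{-1}(\sigma)}x_\tau\ (\sigma\in G').$$ For a divisor $d$ of $n$ let $\Gamma^d=\{\sigma^d:\sigma\in\Gamma\}$, let $p^d:\Gamma\to\Gamma^d$ be the map $\sigma\mapsto\sigma^d$ and $i_d:\Gamma^d\to\Gamma$ the inclusion. For $\sigma\in\Gamma$, $\sigma\neq1$, the series $\mathrm{Li}_1(\sigma)=\sum_{m\ge1}\sigma^m/m$ converges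 (conditionally). **Proposition (regularised distribution relation).** For every divisor $d$ of $n$, one has in $\mathbb{C}\langle\langle\mathbf{X}_{\Gamma^d}\rangle\rangle$ $$p^d_*(\mathcal{I})=\exp\Big(\sum_{\sigma\in\Gamma,\ \sigma^{d}=1,\ \sigma\neq1}\mathrm{Li}_1(\sigma)\,x_1\Big)\; i_d^*(\mathcal{I}).$$ -/

import Mathlib

open Filter Topology

namespace RegDist

noncomputable section

/-! ### Formal power series in non-commuting variables -/

/-- Series `∑ F(w) w` with complex coefficients, over the words `w` in the alphabet `A`;
`F w` is the coefficient of the word `w`. -/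
def NCSeries (A : Type*) := List A → ℂ

namespace NCSeries

variable {A B : Type*}

instance : One (NCSeries A) :=
  ⟨fun w => if w = [] then 1 else 0⟩

/-- The concatenation (Cauchy) product. -/
instance : Mul (NCSeries A) :=
  ⟨fun F G w => ∑ i ∈ Finset.range (w.length + 1), F (w.take i) * G (w.drop i)⟩

instance : SMul ℂ (NCSeries A) :=
  ⟨fun c F w => c * F w⟩

/-- The variable `x_a`. -/
def x (a : A) : NCSeries A :=
  open Classical in fun w => if w = [a] then 1 else 0

/-- Powers for the concatenation product. -/
def pow (F : NCSeries A) : ℕ → NCSeries A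
  | 0 => 1
  | k + 1 => F * pow F k

/-- The exponential `∑ Fᵏ / k!` of a series `F` without constant term. The coefficient of a word
`w` in `Fᵏ` vanishes for `k > |w|`, so that the sum for each coefficient is finite. -/
def exp (F : NCSeries A) : NCSeries A :=
  fun w => ∑ k ∈ Finset.range (w.length + 1), pow F k w / (Nat.factorial k : ℂ)

/-- The coproduct of a word, `Δ(x_{a₁} ⋯ x_{aₚ}) = ∏ (x_{aᵢ} ⊗ 1 + 1 ⊗ x_{aᵢ})`, in
`ℂ⟨A⟩ ⊗ ℂ⟨A⟩`, which is the monoid algebra of the monoid of pairs of words. -/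
def coproductWord (w : List A) : MonoidAlgebra ℂ (FreeMonoid A × FreeMonoid A) :=
  (w.map fun a =>
    MonoidAlgebra.single (FreeMonoid.of a, (1 : FreeMonoid A)) (1 : ℂ) +
      MonoidAlgebra.single ((1 : FreeMonoid A), FreeMonoid.of a) (1 : ℂ)).prod

/-- The coefficient of `u ⊗ v` in `Δ F`, for the continuous coproduct `Δ` of series in a finite
alphabet for which all variables are primitive. As `Δ` is homogeneous, only the words of length
`|u| + |v|` contribute. -/
def coproduct (F : NCSeries A) (u v : List A) : ℂ :=
  ∑ᶠ f : Fin (u.length + v.length) → A,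
    F (List.ofFn f) *
      (coproductWord (List.ofFn f)).coeff (FreeMonoid.ofList u, FreeMonoid.ofList v)

/-- Group-like series: the constant term is `1` and `Δ F = F ⊗ F`. -/
def IsGroupLike (F : NCSeries A) : Prop :=
  F [] = 1 ∧ ∀ u v : List A, coproduct F u v = F u * F v

/-- The image of a series under the substitution `x_a ↦ ∑_b θ(a, b) x_b` (continuous morphism of
algebras) for a finite alphabet `A`. The word `x_{a₁} ⋯ x_{aₚ}` goes to
`∏ (∑_b θ(aᵢ, b) x_b)`, in which the coefficient of `x_{b₁} ⋯ x_{bₚ}` is `∏ θ(aᵢ, bᵢ)`. -/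
def substitute (θ : A → B → ℂ) (F : NCSeries A) : NCSeries B :=
  fun v => ∑ᶠ f : Fin v.length → A, F (List.ofFn f) * ∏ i, θ (f i) (v.get i)

end NCSeries

/-! ### Functoriality in the group -/

/-- The index set `G ∪ {0}` of the alphabet of `G`: `none` is the index `0`. -/
abbrev Index (G : Type*) := Option G

section Functoriality

variable {G H : Type*} [Group G] [Group H]

/-- `φ_*` on variables: `x_0 ↦ |ker φ| x_0` and `x_σ ↦ x_{φ(σ)}`. -/
def pushLetter (φ : G →* H) : Index G → Index H → ℂ
  | none, none => (Nat.card φ.ker : ℂ)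
  | some σ, some τ => open Classical in if φ σ = τ then 1 else 0
  | _, _ => 0

/-- `φ^*` on variables: `x_0 ↦ x_0` and `x_σ ↦ ∑_{φ(τ) = σ} x_τ`. -/
def pullLetter (φ : G →* H) : Index H → Index G → ℂ
  | none, none => 1
  | some σ, some τ => open Classical in if φ τ = σ then 1 else 0
  | _, _ => 0

/-- The direct image `φ_*`. -/
def pushforward (φ : G →* H) (F : NCSeries (Index G)) : NCSeries (Index H) :=
  NCSeries.substitute (pushLetter φ) F

/-- The inverse image `φ^*`. -/
def pullback (φ : G →* H) (F : NCSeries (Index H)) : NCSeries (Index G) :=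
  NCSeries.substitute (pullLetter φ) F

end Functoriality

/-- The subgroup `G^d` of the `d`-th powers. -/
abbrev powers (G : Type*) [CommGroup G] (d : ℕ) : Subgroup G := (powMonoidHom d : G →* G).range

/-- `p^d : G → G^d`, `σ ↦ σ^d`. -/
def powMap (G : Type*) [CommGroup G] (d : ℕ) : G →* powers G d :=
  (powMonoidHom d : G →* G).rangeRestrict

/-- The inclusion `i_d : G^d → G`. -/
def powIncl (G : Type*) [CommGroup G] (d : ℕ) : powers G d →* G :=
  (powers G d).subtype

/-! ### Iterated integrals and the regularised series -/

/-- The density of `ω_0 = dt / t` and `ω_σ = dt / (σ⁻¹ - t)`. -/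
def form {Γ : Subgroup ℂˣ} : Index Γ → ℝ → ℂ
  | none, t => 1 / (t : ℂ)
  | some σ, t => 1 / ((((σ : ℂˣ) : ℂ))⁻¹ - (t : ℂ))

/-- The iterated integral
`I_{[a,b]}(a₁, …, aₚ) = ∫_a^b ω_{a₁}(t₁) ∫_a^{t₁} ω_{a₂}(t₂) ⋯ ∫_a^{t_{p-1}} ω_{aₚ}(tₚ)`. -/
def iteratedIntegral {Γ : Subgroup ℂˣ} (a : ℝ) : List (Index Γ) → ℝ → ℂ
  | [], _ => 1
  | s :: w, b => ∫ t in a..b, form s t * iteratedIntegral a w t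

/-- Words that do not begin with `x_1` and do not end with `x_0`. -/
def IsConvergent {Γ : Subgroup ℂˣ} (w : List (Index Γ)) : Prop :=
  w.head? ≠ some (some 1) ∧ w.getLast? ≠ some none

/-- The characterisation of the regularised series of iterated integrals from `0` to `1`: it is
group-like, its coefficient at a convergent word is the limit of the iterated integrals along
`[a, b]` for `a → 0⁺`, `b → 1⁻`, and its coefficients at `x_0` and `x_1` vanish. -/
structure IsRegularisedSeries (Γ : Subgroup ℂˣ) (I : NCSeries (Index Γ)) : Prop where
  groupLike : NCSeries.IsGroupLike I
  convergent : ∀ w : List (Index Γ), IsConvergent w →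
    Tendsto (fun p : ℝ × ℝ => iteratedIntegral p.1 w p.2) (𝓝[>] 0 ×ˢ 𝓝[<] 1) (𝓝 (I w))
  coeff_x0 : I [none] = 0
  coeff_x1 : I [some 1] = 0

/-- The partial sums of `Li_1(z) = ∑_{m ≥ 1} z^m / m`. -/
def Li1Partial (z : ℂ) (N : ℕ) : ℂ := ∑ m ∈ Finset.Icc 1 N, z ^ m / (m : ℂ)

/-- `Li_1(z) = ∑_{m ≥ 1} z^m / m` as the limit of the partial sums (the series need not converge
absolutely on the unit circle). -/
def Li1 (z : ℂ) : ℂ := limUnder atTop (Li1Partial z)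

end

end RegDist

/-! The relation comes from the substitution `t ↦ t ^ d`. It pulls `dt/t` back to `d · dt/t`, and
`ω_τ` back to the sum of the `ω_σ` with `σ ^ d = τ`. So on segments inside `(0, 1)` the direct image
of the series on `[a, b]` is exactly the inverse image of the series on `[a ^ d, b ^ d]`, with no
correcting factor (`pushforward_integralSeries`).

The correction is an effect of regularisation. The series `I` of iterated integrals on `[a, b]` is
group-like. Multiplying it by `exp(-I(x_1) x_1)` on the left and `exp(-I(x_0) x_0)` on the right
kills its coefficients at `x_0` and `x_1` and leaves those at convergent words unchanged. By the
shuffle relations, every coefficient of such a series is a universal linear combination of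
coefficients at convergent words (`reducible_of_isGroupLike`). The latter converge
(`exists_tendsto_integralSeries`), so the modified series converges coefficientwise, and its limit
is the regularised series; this gives existence and uniqueness together.

In the exact relation on `[a, b]` the two `x_0` factors agree, while the `x_1` factors leave the
exponential of the difference of the coefficients at `x_1` on `[a ^ d, b ^ d]` and on `[a, b]`. That
difference is the sum of the integrals of `ω_σ` over the `σ ≠ 1` with `σ ^ d = 1`, which tends to
the sum of the `Li₁(σ)`. -/

namespace RegDist

/-! ### Algebra of series: products, shuffles, group-like series, exponentials. -/

namespace NCSeries

variable {A B : Type*}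

/-! ### The concatenation product, by recursion on words -/

/-- Removal of the first letter: `(lderiv a F)(w) = F(a w)`. -/
def lderiv (a : A) (F : NCSeries A) : NCSeries A := fun w => F (a :: w)

theorem lderiv_apply (a : A) (F : NCSeries A) (w : List A) : lderiv a F w = F (a :: w) := rfl

/-- The sum of `φ p q` over the factorisations `w = p q`. -/
def splitSum : (List A → List A → ℂ) → List A → ℂ
  | φ, [] => φ [] []
  | φ, a :: w => φ [] (a :: w) + splitSum (fun p q => φ (a :: p) q) w

theorem splitSum_linear (c : ℂ) (φ ψ : List A → List A → ℂ) (w : List A) :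
    splitSum (fun p q => c * φ p q + ψ p q) w = c * splitSum φ w + splitSum ψ w := by
  induction w generalizing φ ψ with
  | nil => rfl
  | cons a w ih => simp only [splitSum]; rw [ih]; ring

theorem splitSum_add (φ ψ : List A → List A → ℂ) (w : List A) :
    splitSum (fun p q => φ p q + ψ p q) w = splitSum φ w + splitSum ψ w := by
  simpa using splitSum_linear 1 φ ψ w

theorem splitSum_zero (w : List A) : splitSum (fun _ _ => 0) w = 0 := by
  induction w with
  | nil => rfl
  | cons a w ih => simp [splitSum, ih]

theorem splitSum_const_mul (c : ℂ) (φ : List A → List A → ℂ) (w : List A) :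
    splitSum (fun p q => c * φ p q) w = c * splitSum φ w := by
  simpa [splitSum_zero] using splitSum_linear c φ (fun _ _ => 0) w

theorem mul_apply (F G : NCSeries A) (w : List A) :
    (F * G) w = ∑ i ∈ Finset.range (w.length + 1), F (w.take i) * G (w.drop i) := rfl

theorem mul_nil (F G : NCSeries A) : (F * G) [] = F [] * G [] := by
  simp [mul_apply]

theorem mul_cons (F G : NCSeries A) (a : A) (w : List A) :
    (F * G) (a :: w) = F [] * G (a :: w) + (lderiv a F * G) w := by
  rw [mul_apply, mul_apply, List.length_cons, Finset.sum_range_succ', add_comm]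
  simp [lderiv]

theorem mul_eq_splitSum (F G : NCSeries A) (w : List A) :
    (F * G) w = splitSum (fun p q => F p * G q) w := by
  induction w generalizing F with
  | nil => rw [mul_nil]; rfl
  | cons a w ih => rw [mul_cons, ih]; rfl

/-- The series `c F + G`. -/
def linComb (c : ℂ) (F G : NCSeries A) : NCSeries A := fun w => c * F w + G w

theorem linComb_apply (c : ℂ) (F G : NCSeries A) (w : List A) :
    linComb c F G w = c * F w + G w := rfl

theorem lderiv_linComb (a : A) (c : ℂ) (F G : NCSeries A) :
    lderiv a (linComb c F G) = linComb c (lderiv a F) (lderiv a G) := rfl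

/-- A Leibniz rule: the first letter of a word comes from `F`, or from `G` when the factor in `F` is
empty. It drives the inductions on words below. -/
theorem lderiv_mul (F G : NCSeries A) (a : A) :
    lderiv a (F * G) = linComb (F []) (lderiv a G) (lderiv a F * G) :=
  funext fun w => mul_cons F G a w

theorem linComb_mul_apply (c : ℂ) (F G H : NCSeries A) (w : List A) :
    (linComb c F G * H) w = c * (F * H) w + (G * H) w := by
  simp only [mul_apply, linComb_apply, add_mul, mul_assoc, Finset.sum_add_distrib, Finset.mul_sum]

theorem mul_assoc (F G H : NCSeries A) : F * G * H = F * (G * H) := by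
  funext w
  induction w generalizing F with
  | nil => simp only [mul_nil, _root_.mul_assoc]
  | cons a w ih =>
    rw [mul_cons, mul_cons, mul_nil, lderiv_mul, linComb_mul_apply, ih, mul_cons G]
    ring

/-! ### Shuffles -/

/-- The sum of the coefficients of `F` at the shuffles of `u` and `v`, with multiplicities. -/
def shuffleSum : NCSeries A → List A → List A → ℂ
  | F, [], v => F v
  | F, a :: u, [] => F (a :: u)
  | F, a :: u, b :: v =>
    shuffleSum (lderiv a F) u (b :: v) + shuffleSum (lderiv b F) (a :: u) v
termination_by _ u v => u.length + v.length

@[simp]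
theorem shuffleSum_nil_left (F : NCSeries A) (v : List A) : shuffleSum F [] v = F v := by
  rw [shuffleSum]

@[simp]
theorem shuffleSum_nil_right (F : NCSeries A) (u : List A) : shuffleSum F u [] = F u := by
  cases u <;> rw [shuffleSum]

theorem shuffleSum_cons_cons (F : NCSeries A) (a b : A) (u v : List A) :
    shuffleSum F (a :: u) (b :: v) =
      shuffleSum (lderiv a F) u (b :: v) + shuffleSum (lderiv b F) (a :: u) v := by
  rw [shuffleSum]

theorem shuffleSum_linComb (c : ℂ) (F G : NCSeries A) (u v : List A) :
    shuffleSum (linComb c F G) u v = c * shuffleSum F u v + shuffleSum G u v := by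
  induction u generalizing F G v with
  | nil => simp [linComb_apply]
  | cons a u ihu =>
    induction v generalizing F G with
    | nil => simp [linComb_apply]
    | cons b v ihv =>
      simp only [shuffleSum_cons_cons, lderiv_linComb, ihu, ihv]
      ring

theorem smul_apply (c : ℂ) (F : NCSeries A) (w : List A) : (c • F) w = c * F w := rfl

theorem lderiv_smul (a : A) (c : ℂ) (F : NCSeries A) : lderiv a (c • F) = c • lderiv a F := rfl

theorem shuffleSum_smul (c : ℂ) (F : NCSeries A) (u v : List A) :
    shuffleSum (c • F) u v = c * shuffleSum F u v := by
  induction u generalizing F v with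
  | nil => simp [smul_apply]
  | cons a u ihu =>
    induction v generalizing F with
    | nil => simp [smul_apply]
    | cons b v ihv =>
      simp only [shuffleSum_cons_cons, lderiv_smul, ihu, ihv]
      ring

theorem shuffleSum_eq_zero {F : NCSeries A} (hF : ∀ w, F w = 0) (u v : List A) :
    shuffleSum F u v = 0 := by
  have h : F = (0 : ℂ) • F := funext fun w => by rw [smul_apply, hF, mul_zero]
  rw [h, shuffleSum_smul, zero_mul]

/-- The multiplicativity of `Δ`, read on coefficients. -/
theorem shuffleSum_mul (F G : NCSeries A) (u v : List A) :
    shuffleSum (F * G) u v =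
      splitSum (fun u₁ u₂ =>
        splitSum (fun v₁ v₂ => shuffleSum F u₁ v₁ * shuffleSum G u₂ v₂) v) u := by
  induction u generalizing F G v with
  | nil => simp [splitSum, mul_eq_splitSum]
  | cons a u ihu =>
    induction v generalizing F G with
    | nil => simp [splitSum, mul_eq_splitSum]
    | cons b v ihv =>
      rw [shuffleSum_cons_cons, lderiv_mul, lderiv_mul, shuffleSum_linComb, shuffleSum_linComb,
        ihu, ihv]
      simp only [splitSum, splitSum_add, shuffleSum_nil_left, shuffleSum_nil_right,
        shuffleSum_cons_cons, lderiv_apply, add_mul, mul_add]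
      ring

/-- The coefficient of a word in the coproduct, by recursion on the word. -/
theorem coproductWord_cons_coeff (a : A) (w u v : List A) :
    (coproductWord (a :: w)).coeff (FreeMonoid.ofList u, FreeMonoid.ofList v) =
      (MonoidAlgebra.single (FreeMonoid.of a, (1 : FreeMonoid A)) (1 : ℂ) *
        coproductWord w).coeff (FreeMonoid.ofList u, FreeMonoid.ofList v) +
      (MonoidAlgebra.single ((1 : FreeMonoid A), FreeMonoid.of a) (1 : ℂ) *
        coproductWord w).coeff (FreeMonoid.ofList u, FreeMonoid.ofList v) := by
  simp [coproductWord, add_mul]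

open Classical in
theorem coeff_single_left_mul (a b : A) (X : MonoidAlgebra ℂ (FreeMonoid A × FreeMonoid A))
    (u v : List A) :
    (MonoidAlgebra.single (FreeMonoid.of a, (1 : FreeMonoid A)) (1 : ℂ) * X).coeff
      (FreeMonoid.ofList (b :: u), FreeMonoid.ofList v) =
    if a = b then X.coeff (FreeMonoid.ofList u, FreeMonoid.ofList v) else 0 := by
  split_ifs with h
  · subst h
    rw [MonoidAlgebra.coeff_single_mul_eq_mul_coeff (m₂ := (FreeMonoid.ofList u,
      FreeMonoid.ofList v)), one_mul]
    rintro ⟨p, q⟩ -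
    simp [Prod.ext_iff, FreeMonoid.ofList_cons]
  · refine MonoidAlgebra.coeff_single_mul_of_forall_mul_ne _ _ ?_
    rintro ⟨p, q⟩ hp
    exact h (List.cons.inj (congrArg (fun z => FreeMonoid.toList z.1) hp)).1

open Classical in
theorem coeff_single_right_mul (a b : A) (X : MonoidAlgebra ℂ (FreeMonoid A × FreeMonoid A))
    (u v : List A) :
    (MonoidAlgebra.single ((1 : FreeMonoid A), FreeMonoid.of a) (1 : ℂ) * X).coeff
      (FreeMonoid.ofList u, FreeMonoid.ofList (b :: v)) =
    if a = b then X.coeff (FreeMonoid.ofList u, FreeMonoid.ofList v) else 0 := by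
  split_ifs with h
  · subst h
    rw [MonoidAlgebra.coeff_single_mul_eq_mul_coeff (m₂ := (FreeMonoid.ofList u,
      FreeMonoid.ofList v)), one_mul]
    rintro ⟨p, q⟩ -
    simp [Prod.ext_iff, FreeMonoid.ofList_cons]
  · refine MonoidAlgebra.coeff_single_mul_of_forall_mul_ne _ _ ?_
    rintro ⟨p, q⟩ hp
    exact h (List.cons.inj (congrArg (fun z => FreeMonoid.toList z.2) hp)).1

theorem coeff_single_left_mul_nil (a : A) (X : MonoidAlgebra ℂ (FreeMonoid A × FreeMonoid A))
    (v : List A) :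
    (MonoidAlgebra.single (FreeMonoid.of a, (1 : FreeMonoid A)) (1 : ℂ) * X).coeff
      (FreeMonoid.ofList [], FreeMonoid.ofList v) = 0 := by
  refine MonoidAlgebra.coeff_single_mul_of_forall_mul_ne _ _ ?_
  rintro ⟨p, q⟩ hp
  exact List.cons_ne_nil _ _ (congrArg (fun z => FreeMonoid.toList z.1) hp)

theorem coeff_single_right_mul_nil (a : A) (X : MonoidAlgebra ℂ (FreeMonoid A × FreeMonoid A))
    (u : List A) :
    (MonoidAlgebra.single ((1 : FreeMonoid A), FreeMonoid.of a) (1 : ℂ) * X).coeff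
      (FreeMonoid.ofList u, FreeMonoid.ofList []) = 0 := by
  refine MonoidAlgebra.coeff_single_mul_of_forall_mul_ne _ _ ?_
  rintro ⟨p, q⟩ hp
  exact List.cons_ne_nil _ _ (congrArg (fun z => FreeMonoid.toList z.2) hp)

theorem sum_words_succ [Fintype A] (n : ℕ) (φ : List A → ℂ) :
    ∑ f : Fin (n + 1) → A, φ (List.ofFn f) =
      ∑ a : A, ∑ f : Fin n → A, φ (a :: List.ofFn f) := by
  rw [← (Fin.consEquiv fun _ => A).sum_comp, Fintype.sum_prod_type]
  simp [Fin.consEquiv, List.ofFn_succ]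

/-- A word contributing to `u ⊗ v` takes its first letter from the head of `u` or from the head of
`v`, which is the recursion defining `shuffleSum`. -/
theorem sum_words_coproduct [Fintype A] (F : NCSeries A) (n : ℕ) (u v : List A)
    (hn : u.length + v.length = n) :
    ∑ f : Fin n → A, F (List.ofFn f) *
      (coproductWord (List.ofFn f)).coeff (FreeMonoid.ofList u, FreeMonoid.ofList v) =
      shuffleSum F u v := by
  classical
  induction n generalizing F u v with
  | zero =>
    obtain ⟨hu, hv⟩ : u.length = 0 ∧ v.length = 0 := by omega
    rw [List.length_eq_zero_iff] at hu hv
    subst hu hv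
    rw [Finset.sum_eq_single default (by simp) (by simp), shuffleSum_nil_left]
    have h : (coproductWord ([] : List A)).coeff (FreeMonoid.ofList [], FreeMonoid.ofList []) = 1 :=
      Finsupp.single_eq_same
    rw [List.ofFn_zero, h, mul_one]
  | succ n ih =>
    rw [sum_words_succ n fun w => F w *
      (coproductWord w).coeff (FreeMonoid.ofList u, FreeMonoid.ofList v)]
    simp only [coproductWord_cons_coeff, mul_add, Finset.sum_add_distrib]
    have hl : ∀ (a : A) (u' : List A), u = a :: u' → (∑ c : A, ∑ f : Fin n → A,
        F (c :: List.ofFn f) * (MonoidAlgebra.single (FreeMonoid.of c, (1 : FreeMonoid A)) (1 : ℂ) *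
          coproductWord (List.ofFn f)).coeff (FreeMonoid.ofList u, FreeMonoid.ofList v)) =
          shuffleSum (lderiv a F) u' v := by
      rintro a u' rfl
      simp only [coeff_single_left_mul]
      rw [Finset.sum_eq_single a (by simp +contextual) (by simp), ← ih]
      · simp [lderiv]
      · simp at hn; omega
    have hr : ∀ (b : A) (v' : List A), v = b :: v' → (∑ c : A, ∑ f : Fin n → A,
        F (c :: List.ofFn f) * (MonoidAlgebra.single ((1 : FreeMonoid A), FreeMonoid.of c) (1 : ℂ) *
          coproductWord (List.ofFn f)).coeff (FreeMonoid.ofList u, FreeMonoid.ofList v)) =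
          shuffleSum (lderiv b F) u v' := by
      rintro a u' rfl
      simp only [coeff_single_right_mul]
      rw [Finset.sum_eq_single a (by simp +contextual) (by simp), ← ih]
      · simp [lderiv]
      · simp at hn; omega
    cases u with
    | nil =>
      cases v with
      | nil => simp at hn
      | cons b v =>
        rw [hr b v rfl]
        simp only [coeff_single_left_mul_nil]
        simp [lderiv]
    | cons a u =>
      cases v with
      | nil =>
        rw [hl a u rfl]
        simp only [coeff_single_right_mul_nil]
        simp [lderiv]
      | cons b v => rw [hl a u rfl, hr b v rfl, shuffleSum_cons_cons]

theorem coproduct_eq_shuffleSum [Finite A] (F : NCSeries A) (u v : List A) :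
    coproduct F u v = shuffleSum F u v := by
  cases nonempty_fintype A
  rw [coproduct, finsum_eq_sum_of_fintype]
  exact sum_words_coproduct F _ u v rfl

theorem isGroupLike_iff [Finite A] {F : NCSeries A} :
    IsGroupLike F ↔ F [] = 1 ∧ ∀ u v, shuffleSum F u v = F u * F v := by
  simp only [IsGroupLike, coproduct_eq_shuffleSum]

theorem IsGroupLike.mul [Finite A] {F G : NCSeries A} (hF : IsGroupLike F)
    (hG : IsGroupLike G) : IsGroupLike (F * G) := by
  rw [isGroupLike_iff] at *
  refine ⟨by rw [mul_nil, hF.1, hG.1, one_mul], fun u v => ?_⟩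
  rw [shuffleSum_mul, mul_eq_splitSum, mul_eq_splitSum, mul_comm, ← splitSum_const_mul]
  congr 1
  funext u₁ u₂
  rw [mul_comm, ← splitSum_const_mul]
  congr 1
  funext v₁ v₂
  rw [hF.2, hG.2]
  ring

/-! ### Series in one variable -/

open Classical in
/-- The series `∑ f(k) x_aᵏ`. -/
noncomputable def univariate (a : A) (f : ℕ → ℂ) : NCSeries A :=
  fun w => if ∀ b ∈ w, b = a then f w.length else 0

@[simp]
theorem univariate_nil (a : A) (f : ℕ → ℂ) : univariate a f [] = f 0 := by
  simp [univariate]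

theorem lderiv_univariate_self (a : A) (f : ℕ → ℂ) :
    lderiv a (univariate a f) = univariate a fun k => f (k + 1) := by
  funext w
  have h : (∀ b ∈ a :: w, b = a) ↔ ∀ b ∈ w, b = a := by simp
  by_cases hw : ∀ b ∈ w, b = a
  · exact (if_pos (h.2 hw)).trans (if_pos hw).symm
  · exact (if_neg (mt h.1 hw)).trans (if_neg hw).symm

theorem univariate_zero (a : A) (w : List A) : univariate a (fun _ => 0) w = 0 := by
  simp [univariate]

theorem lderiv_univariate_of_ne {a b : A} (h : b ≠ a) (f : ℕ → ℂ) :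
    lderiv b (univariate a f) = univariate a fun _ => 0 := by
  funext w
  rw [univariate_zero]
  simp [lderiv, univariate, h]

theorem univariate_mul (a : A) (f g : ℕ → ℂ) :
    univariate a f * univariate a g =
      univariate a fun n => ∑ i ∈ Finset.range (n + 1), f i * g (n - i) := by
  funext w
  induction w generalizing f with
  | nil => simp [mul_nil]
  | cons b w ih =>
    rw [mul_cons, ← lderiv_apply b (univariate a g), ← lderiv_apply b (univariate a fun n => _)]
    by_cases h : b = a
    · subst h
      simp only [lderiv_univariate_self, ih, univariate_nil]
      simp only [univariate]
      split_ifs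
      · rw [Finset.sum_range_succ' _ (w.length + 1), add_comm]
        simp
      · simp
    · simp only [lderiv_univariate_of_ne h, ih]
      simp [univariate_zero]

theorem smul_x_eq_univariate (a : A) (c : ℂ) :
    c • x a = univariate a fun n => if n = 1 then c else 0 := by
  funext w
  change c * x a w = _
  rcases w with _ | ⟨b, _ | ⟨b', w⟩⟩ <;> simp only [x, univariate]
  · simp
  · by_cases h : b = a <;> simp [h]
  · simp

theorem pow_smul_x (a : A) (c : ℂ) (k : ℕ) :
    pow (c • x a) k = univariate a fun n => if n = k then c ^ k else 0 := by
  induction k with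
  | zero =>
    funext w
    change (if w = [] then (1 : ℂ) else 0) = _
    cases w <;> simp [univariate]
  | succ k ih =>
    rw [pow, ih, smul_x_eq_univariate, univariate_mul]
    congr 1
    funext n
    cases n with
    | zero => simp
    | succ n =>
      rw [Finset.sum_eq_single 1 (by simp +contextual) (by simp)]
      simp [pow_succ']

/-- `exp(c x_a) = ∑ cᵏ x_aᵏ / k!`. -/
theorem exp_smul_x (a : A) (c : ℂ) :
    exp (c • x a) = univariate a fun n => c ^ n / (n.factorial : ℂ) := by
  funext w
  rw [exp]
  simp only [pow_smul_x, univariate]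
  split_ifs
  · rw [Finset.sum_eq_single w.length]
    · simp
    · intro k _ hk
      rw [if_neg hk.symm, zero_div]
    · simp
  · simp

theorem exp_smul_x_mul (a : A) (c d : ℂ) :
    exp (c • x a) * exp (d • x a) = exp ((c + d) • x a) := by
  rw [exp_smul_x, exp_smul_x, exp_smul_x, univariate_mul]
  congr 1
  funext n
  rw [add_pow, Finset.sum_div]
  refine Finset.sum_congr rfl fun i hi => ?_
  rw [Nat.cast_choose ℂ (Finset.mem_range_succ_iff.1 hi)]
  have := Nat.cast_ne_zero (R := ℂ).2 n.factorial_ne_zero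
  field_simp

-- Two powers of one letter have a binomial number of shuffles, all giving the same word; the
-- induction is Pascal's rule.
open Classical in
theorem shuffleSum_univariate (a : A) (f : ℕ → ℂ) (u v : List A) :
    shuffleSum (univariate a f) u v =
      if (∀ b ∈ u, b = a) ∧ ∀ b ∈ v, b = a then
        ((u.length + v.length).choose u.length : ℂ) * f (u.length + v.length) else 0 := by
  induction u generalizing f v with
  | nil => simp [univariate]
  | cons b u ihu =>
    induction v generalizing f with
    | nil => simp [univariate]
    | cons c v ihv =>
      rw [shuffleSum_cons_cons]
      have hz : ∀ u v : List A, shuffleSum (univariate a fun _ => 0) u v = 0 :=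
        shuffleSum_eq_zero (univariate_zero a)
      by_cases hb : b = a
      · by_cases hc : c = a
        · subst hb hc
          rw [lderiv_univariate_self, ihu, ihv]
          simp only [List.forall_mem_cons, true_and, List.length_cons]
          split_ifs
          · rw [show u.length + 1 + (v.length + 1) = u.length + v.length + 1 + 1 by omega,
              Nat.choose_succ_succ, show u.length + 1 + v.length = u.length + v.length + 1 by omega,
              show u.length + (v.length + 1) = u.length + v.length + 1 by omega]
            push_cast
            ring
          · simp
        · rw [lderiv_univariate_of_ne hc, hz, hb, lderiv_univariate_self, ihu]
          simp [hc]
      · rw [lderiv_univariate_of_ne hb, hz]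
        by_cases hc : c = a
        · subst hc
          rw [lderiv_univariate_self, ihv]
          simp [hb]
        · rw [lderiv_univariate_of_ne hc, hz]
          simp [hb]

theorem isGroupLike_exp_smul_x [Finite A] (a : A) (c : ℂ) : IsGroupLike (exp (c • x a)) := by
  rw [isGroupLike_iff, exp_smul_x]
  refine ⟨by simp, fun u v => ?_⟩
  rw [shuffleSum_univariate]
  simp only [univariate]
  by_cases hu : ∀ b ∈ u, b = a
  · by_cases hv : ∀ b ∈ v, b = a
    · rw [if_pos ⟨hu, hv⟩, if_pos hu, if_pos hv, Nat.cast_add_choose]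
      have := Nat.cast_ne_zero (R := ℂ).2 (u.length + v.length).factorial_ne_zero
      field_simp
      ring
    · simp [hv]
  · simp [hu]

end NCSeries

end RegDist

/-! ### Shuffle regularisation; limits, derivatives and substitutions of series. -/

namespace RegDist

namespace NCSeries

variable {A B : Type*}

/-! ### Reduction to convergent words -/

/-- The series with the words read backwards. -/
def rev (F : NCSeries A) : NCSeries A := fun w => F w.reverse

/-- The sum of the coefficients of `F` at the insertions of the letter `a` in the word `v`. -/
def insertSum (a : A) (F : NCSeries A) (v : List A) : ℂ :=
  splitSum (fun p q => F (p ++ a :: q)) v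

theorem insertSum_nil (a : A) (F : NCSeries A) : insertSum a F [] = F [a] := rfl

theorem insertSum_cons (a b : A) (F : NCSeries A) (v : List A) :
    insertSum a F (b :: v) = F (a :: b :: v) + insertSum a (lderiv b F) v := rfl

theorem shuffleSum_singleton (a : A) (F : NCSeries A) (v : List A) :
    shuffleSum F [a] v = insertSum a F v := by
  induction v generalizing F with
  | nil => simp [insertSum_nil]
  | cons b v ih =>
    rw [shuffleSum_cons_cons, ih, insertSum_cons, shuffleSum_nil_left, lderiv_apply]

theorem splitSum_append_singleton (φ : List A → List A → ℂ) (v : List A) (b : A) :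
    splitSum φ (v ++ [b]) = splitSum (fun p q => φ p (q ++ [b])) v + φ (v ++ [b]) [] := by
  induction v generalizing φ with
  | nil => rfl
  | cons a v ih =>
    rw [List.cons_append, splitSum, ih, splitSum]
    simp only [List.cons_append]
    ring

theorem splitSum_reverse (φ : List A → List A → ℂ) (v : List A) :
    splitSum φ v.reverse = splitSum (fun p q => φ q.reverse p.reverse) v := by
  induction v generalizing φ with
  | nil => rfl
  | cons a v ih =>
    rw [List.reverse_cons, splitSum_append_singleton, ih, splitSum]
    simp only [List.reverse_cons, List.reverse_nil]
    ring

theorem insertSum_rev (a : A) (F : NCSeries A) (v : List A) :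
    insertSum a (rev F) v = insertSum a F v.reverse := by
  rw [insertSum, insertSum, splitSum_reverse]
  simp [rev]

/-- Functionals which agree on the series in `K` with finite linear combinations of coefficients
at words in `P`. -/
inductive Reducible (K : Set (NCSeries A)) (P : List A → Prop) : (NCSeries A → ℂ) → Prop
  | of (w : List A) (h : P w) : Reducible K P fun F => F w
  | zero : Reducible K P fun _ => 0
  | linear (c : ℂ) {Φ Ψ : NCSeries A → ℂ} (h : Reducible K P Φ) (h' : Reducible K P Ψ) :
      Reducible K P fun F => c * Φ F + Ψ F
  | congr {Φ Ψ : NCSeries A → ℂ} (h : Reducible K P Φ) (h' : ∀ F ∈ K, Ψ F = Φ F) :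
      Reducible K P Ψ

/-- Reading words backwards exchanges first and last letters, so that one reduction lemma serves
both ends of a word. -/
theorem Reducible.comp_rev {K K' : Set (NCSeries A)} {P P' : List A → Prop}
    (hK : ∀ F ∈ K, rev F ∈ K') (hP : ∀ w, P' w → P w.reverse) {Φ : NCSeries A → ℂ}
    (h : Reducible K' P' Φ) : Reducible K P fun F => Φ (rev F) := by
  induction h with
  | of w h => exact .of _ (hP w h)
  | zero => exact .zero
  | linear c _ _ ih ih' => exact .linear c ih ih'
  | congr _ h' ih => exact .congr ih fun F hF => h' _ (hK F hF)

theorem Reducible.trans {K : Set (NCSeries A)} {P Q : List A → Prop} {Φ : NCSeries A → ℂ}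
    (h : Reducible K P Φ) (hPQ : ∀ w, P w → Reducible K Q fun F => F w) : Reducible K Q Φ := by
  induction h with
  | of w h => exact hPQ w h
  | zero => exact .zero
  | linear c _ _ ih ih' => exact .linear c ih ih'
  | congr _ h' ih => exact .congr ih h'

/-- Removal of a prefix. -/
def lderivWord (p : List A) (F : NCSeries A) : NCSeries A := fun w => F (p ++ w)

theorem lderivWord_apply (p : List A) (F : NCSeries A) (w : List A) :
    lderivWord p F w = F (p ++ w) := rfl

theorem lderiv_lderivWord (b : A) (p : List A) (F : NCSeries A) :
    lderiv b (lderivWord p F) = lderivWord (p ++ [b]) F := by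
  funext w
  simp [lderiv_apply, lderivWord_apply]

theorem lderivWord_lderiv (b : A) (p : List A) (F : NCSeries A) :
    lderivWord p (lderiv b F) = lderivWord (b :: p) F := rfl

theorem Reducible.insertSum {K : Set (NCSeries A)} {P : List A → Prop} (a : A) (r v : List A)
    (h : ∀ p q, v = p ++ q → Reducible K P fun F => F (r ++ (p ++ a :: q))) :
    Reducible K P fun F => insertSum a (lderivWord r F) v := by
  induction v generalizing r with
  | nil => exact h [] [] rfl
  | cons b v ih =>
    have h2 := ih (r ++ [b]) fun p q hpq => by simpa using h (b :: p) q (by simp [hpq])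
    refine (Reducible.linear 1 (h [] (b :: v) rfl) h2).congr fun F _ => ?_
    rw [insertSum_cons, lderiv_lderivWord, one_mul]
    rfl

/-- Inserting `a` in or next to the block `aᵏ` gives the same word `k + 1` times; the insertion just
before `v` is counted in the last term, hence the coefficient `k`. -/
theorem insertSum_replicate_append (a : A) (k : ℕ) (F : NCSeries A) (v : List A) :
    NCSeries.insertSum a F (List.replicate k a ++ v) =
      k * F (List.replicate (k + 1) a ++ v) +
        NCSeries.insertSum a (lderivWord (List.replicate k a) F) v := by
  induction k generalizing F with
  | zero =>
    simp only [Nat.cast_zero, zero_mul, zero_add, List.replicate_zero, List.nil_append]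
    rfl
  | succ k ih =>
    rw [List.replicate_succ, List.cons_append, insertSum_cons, ih, lderivWord_lderiv, lderiv_apply]
    simp only [List.replicate_succ, List.cons_append]
    push_cast
    ring

/-- If the sums over the insertions of `a` vanish on `K`, then the coefficients at all words are
combinations of those at words which do not begin with `a`. -/
theorem reducible_head_ne {K : Set (NCSeries A)} {a : A} {R : List A → Prop}
    (hK : ∀ F ∈ K, ∀ v, insertSum a F v = 0)
    (hins : ∀ p q, R (p ++ q) → R (p ++ a :: q)) (hdel : ∀ w, R (a :: w) → R w)
    (w : List A) (hw : R w) :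
    Reducible K (fun u => u.head? ≠ some a ∧ R u) fun F => F w := by
  have key : ∀ (k : ℕ) (v : List A), v.head? ≠ some a → R v →
      Reducible K (fun u => u.head? ≠ some a ∧ R u) fun F => F (List.replicate k a ++ v) := by
    intro k
    induction k with
    | zero => exact fun v h h' => .of v ⟨h, h'⟩
    | succ k ih =>
      intro v hv hR
      cases v with
      | nil =>
        -- For a pure power the relation reads `(k + 1) F(aᵏ⁺¹) = 0`.
        refine Reducible.zero.congr fun F hF => ?_
        have h := hK F hF (List.replicate k a ++ [])
        rw [insertSum_replicate_append, insertSum_nil, lderivWord_apply, ← List.replicate_succ',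
          List.append_nil] at h
        rw [List.append_nil]
        have : (k + 1 : ℂ) ≠ 0 := Nat.cast_add_one_ne_zero k
        exact (mul_eq_zero.1 (by linear_combination h)).resolve_left this
      | cons b v =>
        -- The vanishing insertion sum expresses `(k + 1) F(aᵏ⁺¹ b v)` through words `aᵏ b ⋯` with
        -- `a` inserted after `b`. These have a shorter initial block, so the induction on `k`
        -- applies.
        have h2 := Reducible.insertSum (K := K) (P := fun u => u.head? ≠ some a ∧ R u) a
          (List.replicate k a ++ [b]) v fun p q hpq => by
            subst hpq
            simpa using ih (b :: (p ++ a :: q)) hv (hins (b :: p) q hR)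
        refine (Reducible.linear (-(1 / (k + 1 : ℂ))) h2 .zero).congr fun F hF => ?_
        have h := hK F hF (List.replicate k a ++ b :: v)
        rw [insertSum_replicate_append, insertSum_cons, lderiv_lderivWord, lderivWord_apply] at h
        have h3 : List.replicate k a ++ a :: b :: v = List.replicate (k + 1) a ++ b :: v := by
          rw [List.replicate_succ', List.append_assoc]; rfl
        rw [h3] at h
        have : (k + 1 : ℂ) ≠ 0 := Nat.cast_add_one_ne_zero k
        field_simp
        linear_combination h
  have hdec : ∀ w : List A, R w →
      ∃ (k : ℕ) (v : List A), w = List.replicate k a ++ v ∧ v.head? ≠ some a ∧ R v := by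
    intro w hw
    induction w with
    | nil => exact ⟨0, [], by simp, by simp, hw⟩
    | cons b w ih =>
      by_cases h : b = a
      · subst h
        obtain ⟨k, v, rfl, h1, h2⟩ := ih (hdel _ hw)
        exact ⟨k + 1, v, by simp [List.replicate_succ], h1, h2⟩
      · exact ⟨0, b :: w, by simp, by simpa using h, hw⟩
  obtain ⟨k, v, rfl, h1, h2⟩ := hdec w hw
  exact key k v h1 h2

/-- On the group-like series without terms `x_a` and `x_b`, the coefficients at all words are
combinations of those at the words which neither begin with `a` nor end with `b`. -/
theorem reducible_of_isGroupLike [Finite A] {a b : A} (hab : a ≠ b) (w : List A) :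
    Reducible {F | IsGroupLike F ∧ F [a] = 0 ∧ F [b] = 0}
      (fun u => u.head? ≠ some a ∧ u.getLast? ≠ some b) fun F => F w := by
  have hK : ∀ F ∈ {F : NCSeries A | IsGroupLike F ∧ F [a] = 0 ∧ F [b] = 0}, ∀ v,
      insertSum a F v = 0 ∧ insertSum b F v = 0 := by
    rintro F ⟨hF, ha, hb⟩ v
    rw [← shuffleSum_singleton, ← shuffleSum_singleton, (isGroupLike_iff.1 hF).2,
      (isGroupLike_iff.1 hF).2, ha, hb]
    simp
  -- Trailing `b`'s are removed first, on reversed words; the removal of leading `a`'s must then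
  -- preserve the condition on the last letter.
  have h1 : Reducible {F | IsGroupLike F ∧ F [a] = 0 ∧ F [b] = 0}
      (fun u => u.getLast? ≠ some b) fun F => F w := by
    have h := reducible_head_ne (K := rev '' {F | IsGroupLike F ∧ F [a] = 0 ∧ F [b] = 0}) (a := b)
      (R := fun _ => True) (by
        rintro _ ⟨F, hF, rfl⟩ v
        rw [insertSum_rev]
        exact (hK F hF _).2) (by simp) (by simp) w.reverse trivial
    refine (h.comp_rev (P := fun u => u.getLast? ≠ some b)
      (fun F hF => Set.mem_image_of_mem rev hF) ?_).congr ?_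
    · rintro u ⟨hu, -⟩
      simpa using hu
    · intro F _
      exact congrArg F w.reverse_reverse.symm
  refine h1.trans fun u hu => ?_
  refine reducible_head_ne (fun F hF v => (hK F hF v).1) ?_ ?_ u hu
  -- If `q` is empty, the inserted letter becomes the last one; this is where `a ≠ b` enters.
  · intro p q h
    rcases List.eq_nil_or_concat q with rfl | ⟨q, c, rfl⟩
    · simpa using hab
    · rw [List.concat_eq_append, ← List.append_assoc] at h
      rw [List.concat_eq_append, ← List.cons_append, ← List.append_assoc, List.getLast?_concat]
      rwa [List.getLast?_concat] at h
  · intro w h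
    cases w with
    | nil => simp
    | cons c w => simpa using h

/-- Serves to construct the limit series; the next lemma identifies the limit when a candidate in
`K` is given. -/
theorem Reducible.exists_tendsto {K : Set (NCSeries A)} {P : List A → Prop} {ι : Type*}
    {l : Filter ι} {G : ι → NCSeries A} (hG : ∀ᶠ i in l, G i ∈ K)
    (hP : ∀ w, P w → ∃ z, Tendsto (fun i => G i w) l (𝓝 z)) {Φ : NCSeries A → ℂ}
    (h : Reducible K P Φ) : ∃ z, Tendsto (fun i => Φ (G i)) l (𝓝 z) := by
  induction h with
  | of w h => exact hP w h
  | zero => exact ⟨0, tendsto_const_nhds⟩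
  | linear c _ _ ih ih' =>
    obtain ⟨z, hz⟩ := ih
    obtain ⟨z', hz'⟩ := ih'
    exact ⟨c * z + z', (hz.const_mul c).add hz'⟩
  | congr _ h' ih =>
    obtain ⟨z, hz⟩ := ih
    exact ⟨z, hz.congr' (hG.mono fun i hi => (h' _ hi).symm)⟩

theorem Reducible.tendsto {K : Set (NCSeries A)} {P : List A → Prop} {ι : Type*}
    {l : Filter ι} {G : ι → NCSeries A} {I : NCSeries A} (hG : ∀ᶠ i in l, G i ∈ K) (hI : I ∈ K)
    (hP : ∀ w, P w → Tendsto (fun i => G i w) l (𝓝 (I w))) {Φ : NCSeries A → ℂ}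
    (h : Reducible K P Φ) : Tendsto (fun i => Φ (G i)) l (𝓝 (Φ I)) := by
  induction h with
  | of w h => exact hP w h
  | zero => exact tendsto_const_nhds
  | linear c _ _ ih ih' => exact (ih.const_mul c).add ih'
  | congr _ h' ih =>
    rw [h' I hI]
    exact ih.congr' (hG.mono fun i hi => (h' _ hi).symm)

/-! ### Limits and derivatives of coefficients -/

theorem tendsto_mul {ι : Type*} {l : Filter ι} {F G : ι → NCSeries A} {F₀ G₀ : NCSeries A}
    (hF : ∀ w, Tendsto (fun i => F i w) l (𝓝 (F₀ w)))
    (hG : ∀ w, Tendsto (fun i => G i w) l (𝓝 (G₀ w))) (w : List A) :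
    Tendsto (fun i => (F i * G i) w) l (𝓝 ((F₀ * G₀) w)) := by
  simp only [mul_apply]
  exact tendsto_finsetSum _ fun i _ => (hF _).mul (hG _)

theorem tendsto_exp_smul_x {ι : Type*} {l : Filter ι} {c : ι → ℂ} {c₀ : ℂ}
    (hc : Tendsto c l (𝓝 c₀)) (a : A) (w : List A) :
    Tendsto (fun i => exp (c i • x a) w) l (𝓝 (exp (c₀ • x a) w)) := by
  simp only [exp_smul_x, univariate]
  split_ifs
  · exact (hc.pow _).div_const _
  · exact tendsto_const_nhds

theorem tendsto_shuffleSum {ι : Type*} {l : Filter ι} {F : ι → NCSeries A} {F₀ : NCSeries A}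
    (hF : ∀ w, Tendsto (fun i => F i w) l (𝓝 (F₀ w))) (u v : List A) :
    Tendsto (fun i => shuffleSum (F i) u v) l (𝓝 (shuffleSum F₀ u v)) := by
  induction u generalizing F F₀ v with
  | nil => simpa using hF v
  | cons a u ihu =>
    induction v generalizing F F₀ with
    | nil => simpa using hF _
    | cons b v ihv =>
      simp only [shuffleSum_cons_cons]
      exact (ihu (fun w => hF (a :: w)) _).add (ihv fun w => hF (b :: w))

theorem IsGroupLike.of_tendsto [Finite A] {ι : Type*} {l : Filter ι} [l.NeBot]
    {F : ι → NCSeries A} {F₀ : NCSeries A} (h : ∀ᶠ i in l, IsGroupLike (F i))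
    (hF : ∀ w, Tendsto (fun i => F i w) l (𝓝 (F₀ w))) : IsGroupLike F₀ := by
  rw [isGroupLike_iff]
  constructor
  · exact tendsto_nhds_unique (hF []) (tendsto_const_nhds.congr' (h.mono fun i hi => hi.1.symm))
  · intro u v
    exact tendsto_nhds_unique ((tendsto_shuffleSum hF u v).congr'
      (h.mono fun i hi => (isGroupLike_iff.1 hi).2 u v)) ((hF u).mul (hF v))

theorem hasDerivAt_shuffleSum {F : ℝ → NCSeries A} {F' : NCSeries A} {t : ℝ}
    (hF : ∀ w, HasDerivAt (fun s => F s w) (F' w) t) (u v : List A) :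
    HasDerivAt (fun s => shuffleSum (F s) u v) (shuffleSum F' u v) t := by
  induction u generalizing F F' v with
  | nil => simpa using hF v
  | cons a u ihu =>
    induction v generalizing F F' with
    | nil => simpa using hF _
    | cons b v ihv =>
      simp only [shuffleSum_cons_cons]
      exact (ihu (fun w => hF (a :: w)) _).add (ihv fun w => hF (b :: w))

/-! ### Substitutions -/

theorem substitute_apply [Fintype A] (θ : A → B → ℂ) (F : NCSeries A) (v : List B) :
    substitute θ F v = ∑ f : Fin v.length → A, F (List.ofFn f) * ∏ i, θ (f i) (v.get i) := by
  rw [substitute, finsum_eq_sum_of_fintype]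

theorem substitute_nil [Finite A] (θ : A → B → ℂ) (F : NCSeries A) :
    substitute θ F [] = F [] := by
  cases nonempty_fintype A
  rw [substitute_apply]
  change ∑ f : Fin 0 → A, _ = _
  simp

theorem substitute_cons [Fintype A] (θ : A → B → ℂ) (F : NCSeries A) (b : B) (v : List B) :
    substitute θ F (b :: v) = ∑ a, θ a b * substitute θ (lderiv a F) v := by
  rw [substitute_apply]
  change ∑ f : Fin (v.length + 1) → A, _ = _
  rw [← (Fin.consEquiv fun _ => A).sum_comp, Fintype.sum_prod_type]
  refine Finset.sum_congr rfl fun a _ => ?_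
  rw [substitute_apply, Finset.mul_sum]
  refine Finset.sum_congr rfl fun f _ => ?_
  have h : ∏ i : Fin (v.length + 1), θ ((Fin.consEquiv fun _ => A) (a, f) i) ((b :: v).get i) =
      θ a b * ∏ i, θ (f i) (v.get i) := by
    rw [Fin.prod_univ_succ]
    rfl
  have h' : List.ofFn ((Fin.consEquiv fun _ => A) (a, f)) = a :: List.ofFn f := by
    simp [Fin.consEquiv, List.ofFn_succ]
  refine (congrArg₂ (fun x y : ℂ => x * y) (congrArg F h') h).trans ?_
  rw [lderiv_apply]
  ring

theorem substitute_linComb [Finite A] (θ : A → B → ℂ) (c : ℂ) (F G : NCSeries A) (v : List B) :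
    substitute θ (linComb c F G) v = c * substitute θ F v + substitute θ G v := by
  cases nonempty_fintype A
  simp only [substitute_apply, linComb_apply, add_mul, _root_.mul_assoc, Finset.sum_add_distrib,
    Finset.mul_sum]

theorem substitute_mul [Finite A] (θ : A → B → ℂ) (F G : NCSeries A) :
    substitute θ (F * G) = substitute θ F * substitute θ G := by
  cases nonempty_fintype A
  funext v
  induction v generalizing F with
  | nil => simp only [mul_nil, substitute_nil]
  | cons b v ih =>
    rw [substitute_cons, mul_cons, substitute_nil, substitute_cons]
    have h2 : (lderiv b (substitute θ F) * substitute θ G) v =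
        ∑ a, θ a b * (substitute θ (lderiv a F) * substitute θ G) v := by
      simp only [mul_apply, lderiv_apply, substitute_cons, Finset.sum_mul, Finset.mul_sum]
      rw [Finset.sum_comm]
      simp only [_root_.mul_assoc]
    rw [h2, Finset.mul_sum, ← Finset.sum_add_distrib]
    refine Finset.sum_congr rfl fun a _ => ?_
    rw [lderiv_mul, substitute_linComb, ih]
    ring

/-- The hypotheses say that `x_a ↦ z x_b`. Both substitutions of the theorem act in this way on
`x_0` and on the `x_1` of their source that matters, hence on the regularising exponentials. -/
theorem substitute_univariate [Finite A] (θ : A → B → ℂ) {a : A} {b : B} {z : ℂ}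
    (hb : θ a b = z) (hne : ∀ b', b' ≠ b → θ a b' = 0) (f : ℕ → ℂ) :
    substitute θ (univariate a f) = univariate b fun n => f n * z ^ n := by
  cases nonempty_fintype A
  classical
  have hz : ∀ v, substitute θ (univariate a fun _ => 0) v = 0 := by
    intro v
    simp [substitute_apply, univariate_zero]
  funext v
  induction v generalizing f with
  | nil => simp [substitute_nil]
  | cons b' v ih =>
    rw [substitute_cons, Finset.sum_eq_single a, lderiv_univariate_self, ih]
    · rw [← lderiv_apply b' (univariate b _)]
      by_cases h : b' = b
      · rw [h, lderiv_univariate_self, hb]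
        simp only [univariate]
        split_ifs
        · ring
        · ring
      · rw [hne b' h, lderiv_univariate_of_ne h, univariate_zero, zero_mul]
    · intro a' _ ha'
      rw [lderiv_univariate_of_ne ha', hz, mul_zero]
    · simp

theorem substitute_exp_smul_x [Finite A] (θ : A → B → ℂ) {a : A} {b : B} {z : ℂ}
    (hb : θ a b = z) (hne : ∀ b', b' ≠ b → θ a b' = 0) (c : ℂ) :
    substitute θ (exp (c • x a)) = exp ((c * z) • x b) := by
  rw [exp_smul_x, exp_smul_x, substitute_univariate θ hb hne]
  congr 1
  funext n
  rw [mul_pow]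
  ring

theorem tendsto_substitute [Finite A] {ι : Type*} {l : Filter ι} {F : ι → NCSeries A}
    {F₀ : NCSeries A} (θ : A → B → ℂ) (hF : ∀ w, Tendsto (fun i => F i w) l (𝓝 (F₀ w)))
    (v : List B) :
    Tendsto (fun i => substitute θ (F i) v) l (𝓝 (substitute θ F₀ v)) := by
  cases nonempty_fintype A
  simp only [substitute_apply]
  exact tendsto_finsetSum _ fun f _ => (hF _).mul_const _

theorem hasDerivAt_substitute [Finite A] {F : ℝ → NCSeries A} {F' : NCSeries A} {t : ℝ}
    (θ : A → B → ℂ) (hF : ∀ w, HasDerivAt (fun s => F s w) (F' w) t) (v : List B) :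
    HasDerivAt (fun s => substitute θ (F s) v) (substitute θ F' v) t := by
  cases nonempty_fintype A
  simp only [substitute_apply]
  exact HasDerivAt.fun_sum fun f _ => (hF _).mul_const _

end NCSeries

end RegDist

/-! ### Regularising factors; iterated integrals form a group-like series. -/

namespace RegDist

namespace NCSeries

variable {A : Type*}

/-! ### Regularisation of group-like series -/

/-- Every non-constant term of the left factor begins with `a`, so only its constant term reaches
`w`. -/
theorem univariate_mul_apply_of_head_ne {a : A} {f : ℕ → ℂ} (hf : f 0 = 1) (H : NCSeries A)
    {w : List A} (hw : w.head? ≠ some a) : (univariate a f * H) w = H w := by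
  cases w with
  | nil => simp [mul_nil, hf]
  | cons b w =>
    rw [mul_cons, lderiv_univariate_of_ne (by simpa using hw), univariate_nil, hf, one_mul]
    simp [mul_apply, univariate_zero]

theorem univariate_eq_zero {a : A} (f : ℕ → ℂ) {w : List A} {c : A} (hc : c ∈ w) (hca : c ≠ a) :
    univariate a f w = 0 :=
  if_neg fun h => hca (h c hc)

theorem mul_univariate_apply_of_getLast_ne {a : A} {f : ℕ → ℂ} (hf : f 0 = 1) (H : NCSeries A)
    {w : List A} (hw : w.getLast? ≠ some a) : (H * univariate a f) w = H w := by
  induction w generalizing H with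
  | nil => simp [mul_nil, hf]
  | cons b w ih =>
    rcases List.eq_nil_or_concat w with rfl | ⟨w, c, rfl⟩
    · rw [mul_cons, mul_nil, univariate_nil, hf, univariate_eq_zero f (c := b) (by simp)
        (by simpa using hw), lderiv_apply]
      ring
    · have hc : c ≠ a := by
        rw [List.concat_eq_append, ← List.cons_append, List.getLast?_concat] at hw
        simpa using hw
      rw [mul_cons, univariate_eq_zero f (c := c) (by simp) hc, ih, lderiv_apply]
      · ring
      · simpa using hc

/-- The series `exp(-F(x_a) x_a) F exp(-F(x_b) x_b)`. -/
noncomputable def regularise (a b : A) (F : NCSeries A) : NCSeries A :=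
  exp ((-F [a]) • x a) * (F * exp ((-F [b]) • x b))

theorem regularise_apply (a b : A) (F : NCSeries A) {w : List A} (hw : w.head? ≠ some a)
    (hw' : w.getLast? ≠ some b) : regularise a b F w = F w := by
  rw [regularise, exp_smul_x, univariate_mul_apply_of_head_ne (by simp) _ hw, exp_smul_x,
    mul_univariate_apply_of_getLast_ne (by simp) _ hw']

theorem regularise_isGroupLike [Finite A] (a b : A) {F : NCSeries A} (hF : IsGroupLike F) :
    IsGroupLike (regularise a b F) :=
  (isGroupLike_exp_smul_x _ _).mul (hF.mul (isGroupLike_exp_smul_x _ _))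

theorem univariate_singleton (a : A) (f : ℕ → ℂ) : univariate a f [a] = f 1 := by
  simp [univariate]

theorem regularise_left {a b : A} (hab : a ≠ b) {F : NCSeries A} (hF : F [] = 1) :
    regularise a b F [a] = 0 := by
  rw [regularise, mul_cons, mul_nil, lderiv_apply, exp_smul_x, exp_smul_x, mul_nil,
    mul_univariate_apply_of_getLast_ne (by simp) _ (by simpa using hab), univariate_singleton]
  simp [hF]

theorem regularise_right {a b : A} (hab : a ≠ b) {F : NCSeries A} (hF : F [] = 1) :
    regularise a b F [b] = 0 := by
  rw [regularise, exp_smul_x a, univariate_mul_apply_of_head_ne (by simp) _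
    (by simpa using hab.symm), mul_cons, mul_nil, lderiv_apply, exp_smul_x, univariate_singleton]
  simp [hF]

end NCSeries

open NCSeries

/-! ### The series of iterated integrals on `[a, b]` -/

/-- Identities between iterated integrals are proved by differentiating in the upper bound and
comparing at `b = a`. -/
theorem eq_of_hasDerivAt_Ioo {f g h : ℝ → ℂ} (hf : ∀ t ∈ Set.Ioo (0 : ℝ) 1, HasDerivAt f (h t) t)
    (hg : ∀ t ∈ Set.Ioo (0 : ℝ) 1, HasDerivAt g (h t) t) {a b : ℝ} (ha : a ∈ Set.Ioo (0 : ℝ) 1)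
    (hb : b ∈ Set.Ioo (0 : ℝ) 1) (hab : f a = g a) : f b = g b := by
  have hfg : ∀ t ∈ Set.Ioo (0 : ℝ) 1, HasDerivAt (fun s => f s - g s) 0 t := fun t ht => by
    simpa using (hf t ht).fun_sub (hg t ht)
  have := isOpen_Ioo.is_const_of_deriv_eq_zero isPreconnected_Ioo
    (fun t ht => (hfg t ht).differentiableAt.differentiableWithinAt)
    (fun t ht => (hfg t ht).deriv) ha hb
  simp only [hab, sub_self] at this
  exact (sub_eq_zero.1 this.symm)

variable {Γ : Subgroup ℂˣ}

theorem norm_eq_one_of_finite [Finite Γ] (σ : Γ) : ‖((σ : ℂˣ) : ℂ)‖ = 1 := by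
  refine Complex.norm_eq_one_of_pow_eq_one (n := Nat.card Γ) ?_ Nat.card_pos.ne'
  have h : σ ^ Nat.card Γ = 1 := pow_card_eq_one'
  rw [← Units.val_pow_eq_pow_val, ← Subgroup.coe_pow, h]
  simp

theorem inv_sub_ne_zero [Finite Γ] (σ : Γ) {t : ℝ} (ht : t ∈ Set.Ioo (0 : ℝ) 1) :
    (((σ : ℂˣ) : ℂ))⁻¹ - (t : ℂ) ≠ 0 := by
  intro h
  have h2 := congrArg norm (sub_eq_zero.1 h)
  rw [norm_inv, norm_eq_one_of_finite, Complex.norm_real, Real.norm_of_nonneg ht.1.le] at h2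
  linarith [ht.2]

theorem continuousOn_form [Finite Γ] (s : Index Γ) : ContinuousOn (form s) (Set.Ioo 0 1) := by
  cases s with
  | none =>
    refine continuousOn_const.div Complex.continuous_ofReal.continuousOn fun t ht => ?_
    exact_mod_cast ht.1.ne'
  | some σ =>
    exact continuousOn_const.div (continuousOn_const.sub Complex.continuous_ofReal.continuousOn)
      fun t ht => inv_sub_ne_zero σ ht

/-- The series of the iterated integrals on `[a, b]`. -/
noncomputable def integralSeries (Γ : Subgroup ℂˣ) (a b : ℝ) : NCSeries (Index Γ) :=
  fun w => iteratedIntegral a w b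

theorem integralSeries_nil (a b : ℝ) : integralSeries Γ a b [] = 1 := rfl

theorem integralSeries_cons (a b : ℝ) (s : Index Γ) (w : List (Index Γ)) :
    integralSeries Γ a b (s :: w) = ∫ t in a..b, form s t * integralSeries Γ a t w := rfl

theorem integralSeries_self (a : ℝ) {w : List (Index Γ)} (hw : w ≠ []) :
    integralSeries Γ a a w = 0 := by
  cases w with
  | nil => exact absurd rfl hw
  | cons s w => rw [integralSeries_cons, intervalIntegral.integral_same]

/-- The derivative in the upper bound of the series of iterated integrals. -/
noncomputable def integralSeriesDeriv (Γ : Subgroup ℂˣ) (a b : ℝ) : NCSeries (Index Γ)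
  | [] => 0
  | s :: w => form s b * integralSeries Γ a b w

theorem lderiv_integralSeriesDeriv (a b : ℝ) (s : Index Γ) :
    lderiv s (integralSeriesDeriv Γ a b) = form s b • integralSeries Γ a b := rfl

theorem hasDerivAt_integralSeries [Finite Γ] {a b : ℝ} (ha : a ∈ Set.Ioo (0 : ℝ) 1)
    (hb : b ∈ Set.Ioo (0 : ℝ) 1) (w : List (Index Γ)) :
    HasDerivAt (fun t => integralSeries Γ a t w) (integralSeriesDeriv Γ a b w) b := by
  induction w generalizing b with
  | nil => exact hasDerivAt_const _ _
  | cons s w ih =>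
    have hc : ContinuousOn (fun t => form s t * integralSeries Γ a t w) (Set.Ioo 0 1) :=
      (continuousOn_form s).mul fun t ht => (ih ht).continuousAt.continuousWithinAt
    exact intervalIntegral.integral_hasDerivAt_right
      (hc.mono (Set.ordConnected_Ioo.uIcc_subset ha hb)).intervalIntegrable
      (hc.stronglyMeasurableAtFilter isOpen_Ioo b hb) (hc.continuousAt (isOpen_Ioo.mem_nhds hb))

/-- For nonempty words, both sides of the shuffle relation vanish at `b = a`, and by induction the
product rule for the derivative matches the recursion of `shuffleSum`. -/
theorem isGroupLike_integralSeries [Finite Γ] {a b : ℝ} (ha : a ∈ Set.Ioo (0 : ℝ) 1)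
    (hb : b ∈ Set.Ioo (0 : ℝ) 1) : IsGroupLike (integralSeries Γ a b) := by
  rw [isGroupLike_iff]
  refine ⟨rfl, fun u v => ?_⟩
  induction u generalizing b v with
  | nil => simp [integralSeries_nil]
  | cons s u ihu =>
    induction v generalizing b with
    | nil => simp [integralSeries_nil]
    | cons r v ihv =>
      refine eq_of_hasDerivAt_Ioo (f := fun t => shuffleSum (integralSeries Γ a t) (s :: u) (r :: v))
        (g := fun t => integralSeries Γ a t (s :: u) * integralSeries Γ a t (r :: v))
        (fun t ht => hasDerivAt_shuffleSum (fun w => hasDerivAt_integralSeries ha ht w) _ _)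
        (fun t ht => ?_) ha hb ?_
      · rw [shuffleSum_cons_cons, lderiv_integralSeriesDeriv, lderiv_integralSeriesDeriv,
          shuffleSum_smul, shuffleSum_smul, ihu ht, ihv ht]
        refine ((hasDerivAt_integralSeries ha ht (s :: u)).fun_mul
          (hasDerivAt_integralSeries ha ht (r :: v))).congr_deriv ?_
        simp only [integralSeriesDeriv]
        ring
      · have h0 : ∀ (c : Index Γ) w, lderiv c (integralSeries Γ a a) w = 0 := fun c w =>
          integralSeries_self a (List.cons_ne_nil c w)
        simp only [shuffleSum_cons_cons, shuffleSum_eq_zero (h0 _),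
          integralSeries_self a (List.cons_ne_nil s u), add_zero, zero_mul]

end RegDist

/-! ### Estimates: the integrals of convergent words have limits. -/

namespace RegDist

open NCSeries

/-! ### Convergence of the iterated integrals of convergent words -/

/-- A primitive on `(0, 1)` of the function `1/√t + 1/√(1 - t)`. -/
noncomputable def arcBound (t : ℝ) : ℝ := 2 * √t - 2 * √(1 - t)

theorem hasDerivAt_sqrt_one_sub {t : ℝ} (ht : t ∈ Set.Ioo (0 : ℝ) 1) :
    HasDerivAt (fun s => √(1 - s)) (-(1 / (2 * √(1 - t)))) t := by
  have h := ((hasDerivAt_id t).const_sub 1).sqrt (by simpa using (sub_pos.2 ht.2).ne')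
  refine h.congr_deriv ?_
  simp only [id]
  ring

theorem hasDerivAt_arcBound {t : ℝ} (ht : t ∈ Set.Ioo (0 : ℝ) 1) :
    HasDerivAt arcBound (1 / √t + 1 / √(1 - t)) t := by
  refine (((Real.hasDerivAt_sqrt ht.1.ne').const_mul 2).fun_sub
    ((hasDerivAt_sqrt_one_sub ht).const_mul 2)).congr_deriv ?_
  have hx := Real.sqrt_pos.2 ht.1
  have hy := Real.sqrt_pos.2 (sub_pos.2 ht.2)
  field_simp
  ring

theorem hasDerivAt_sqrt_div {t : ℝ} (ht : t ∈ Set.Ioo (0 : ℝ) 1) :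
    HasDerivAt (fun s => √s / √(1 - s)) (1 / (2 * √t * √(1 - t) ^ 3)) t := by
  have hx := Real.sqrt_pos.2 ht.1
  have hy := Real.sqrt_pos.2 (sub_pos.2 ht.2)
  have hx2 := Real.sq_sqrt ht.1.le
  have hy2 := Real.sq_sqrt (sub_pos.2 ht.2).le
  refine ((Real.hasDerivAt_sqrt ht.1.ne').fun_div (hasDerivAt_sqrt_one_sub ht) hy.ne').congr_deriv ?_
  have : √(1 - t) ^ 2 + √t ^ 2 = 1 := by rw [hx2, hy2]; ring
  field_simp
  linear_combination this

theorem hasDerivAt_div_sqrt {t : ℝ} (ht : t ∈ Set.Ioo (0 : ℝ) 1) :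
    HasDerivAt (fun s => s / √(1 - s)) ((1 + √(1 - t) ^ 2) / (2 * √(1 - t) ^ 3)) t := by
  have hy := Real.sqrt_pos.2 (sub_pos.2 ht.2)
  have hy2 := Real.sq_sqrt (sub_pos.2 ht.2).le
  refine ((hasDerivAt_id t).fun_div (hasDerivAt_sqrt_one_sub ht) hy.ne').congr_deriv ?_
  simp only [id]
  field_simp
  linear_combination hy2

/-- Turns each pointwise bound of an integrand into a bound of the integral, through an explicit
primitive `g`. -/
theorem norm_sub_le_of_norm_deriv_le {f f' : ℝ → ℂ} {g g' : ℝ → ℝ}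
    (hf : ∀ t ∈ Set.Ioo (0 : ℝ) 1, HasDerivAt f (f' t) t)
    (hg : ∀ t ∈ Set.Ioo (0 : ℝ) 1, HasDerivAt g (g' t) t) {a b : ℝ} (ha : 0 < a) (hab : a ≤ b)
    (hb : b < 1) (h : ∀ t, a ≤ t → t < b → ‖f' t‖ ≤ g' t) : ‖f b - f a‖ ≤ g b - g a := by
  have hm : ∀ t ∈ Set.Icc a b, t ∈ Set.Ioo (0 : ℝ) 1 := fun t ht =>
    ⟨ha.trans_le ht.1, ht.2.trans_lt hb⟩
  refine image_norm_le_of_norm_deriv_right_le_deriv_boundary' (f := fun t => f t - f a) (f' := f')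
    (B := fun t => g t - g a) (B' := g') ?_ ?_ (by simp) ?_ ?_
    (fun t ht => h t ht.1 ht.2) (Set.right_mem_Icc.2 hab)
  · exact fun t ht => ((hf t (hm t ht)).sub_const _).continuousAt.continuousWithinAt
  · exact fun t ht => ((hf t (hm t (Set.Ico_subset_Icc_self ht))).sub_const _).hasDerivWithinAt
  · exact fun t ht => ((hg t (hm t ht)).sub_const _).continuousAt.continuousWithinAt
  · exact fun t ht => ((hg t (hm t (Set.Ico_subset_Icc_self ht))).sub_const _).hasDerivWithinAt

variable {Γ : Subgroup ℂˣ}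

theorem norm_form_none {t : ℝ} (ht : t ∈ Set.Ioo (0 : ℝ) 1) :
    ‖form (none : Index Γ) t‖ = 1 / t := by
  rw [form, norm_div, norm_one, Complex.norm_real, Real.norm_of_nonneg ht.1.le]

variable [Finite Γ]

theorem norm_form_some_le (σ : Γ) {t : ℝ} (ht : t ∈ Set.Ioo (0 : ℝ) 1) :
    ‖form (some σ) t‖ ≤ 1 / (1 - t) := by
  rw [form, norm_div, norm_one]
  refine one_div_le_one_div_of_le (sub_pos.2 ht.2) ?_
  have h := norm_sub_norm_le (((σ : ℂˣ) : ℂ))⁻¹ (t : ℂ)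
  rwa [norm_inv, norm_eq_one_of_finite, Complex.norm_real, Real.norm_of_nonneg ht.1.le,
    inv_one] at h

theorem norm_form_le (s : Index Γ) {t : ℝ} (ht : t ∈ Set.Ioo (0 : ℝ) 1) :
    ‖form s t‖ ≤ 1 / t + 1 / (1 - t) := by
  have h1 : 0 < 1 / t := one_div_pos.2 ht.1
  have h2 : 0 < 1 / (1 - t) := one_div_pos.2 (sub_pos.2 ht.2)
  cases s with
  | none => rw [norm_form_none ht]; linarith
  | some σ => linarith [norm_form_some_le σ ht]

theorem inv_sub_ne_zero_of_ne_one {σ : Γ} (hσ : σ ≠ 1) {t : ℝ} (ht : 0 ≤ t) :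
    (((σ : ℂˣ) : ℂ))⁻¹ - (t : ℂ) ≠ 0 := by
  intro h
  have h1 := sub_eq_zero.1 h
  have h2 := congrArg norm h1
  rw [norm_inv, norm_eq_one_of_finite, Complex.norm_real, Real.norm_of_nonneg ht, inv_one] at h2
  rw [← h2, Complex.ofReal_one, inv_eq_one] at h1
  exact hσ (Subtype.ext (Units.ext h1))

theorem continuousOn_form_of_ne_one {σ : Γ} (hσ : σ ≠ 1) :
    ContinuousOn (form (some σ)) (Set.Ici 0) :=
  continuousOn_const.div (continuousOn_const.sub Complex.continuous_ofReal.continuousOn)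
    fun _ ht => inv_sub_ne_zero_of_ne_one hσ ht

theorem exists_norm_form_le_of_ne_one {σ : Γ} (hσ : σ ≠ 1) :
    ∃ C, 0 ≤ C ∧ ∀ t ∈ Set.Icc (0 : ℝ) 1, ‖form (some σ) t‖ ≤ C := by
  obtain ⟨C, hC⟩ := isCompact_Icc.exists_bound_of_continuousOn
    ((continuousOn_form_of_ne_one hσ).mono fun t (ht : t ∈ Set.Icc (0 : ℝ) 1) => ht.1)
  exact ⟨C, (norm_nonneg _).trans (hC 0 (by simp)), hC⟩

theorem exists_norm_form_le_div {s : Index Γ} (hs : s ≠ some 1) :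
    ∃ C, 0 ≤ C ∧ ∀ t ∈ Set.Ioo (0 : ℝ) 1, ‖form s t‖ ≤ C / t := by
  cases s with
  | none => exact ⟨1, zero_le_one, fun t ht => (norm_form_none ht).le⟩
  | some σ =>
    obtain ⟨C, hC, h⟩ := exists_norm_form_le_of_ne_one (σ := σ) (by simpa using hs)
    refine ⟨C, hC, fun t ht => (h t (Set.Ioo_subset_Icc_self ht)).trans ?_⟩
    rw [le_div_iff₀ ht.1]
    exact mul_le_of_le_one_right hC ht.2.le

/-- The bound is uniform in `a` and stable under one more integration: the factor `b` absorbs a pole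
at `0`, and `1 / √(1 - b)` dominates the logarithmic growth at `1`. The last letter starts the
induction, its form having no pole at `0`. -/
theorem exists_norm_integralSeries_le (w : List (Index Γ)) (hw : w ≠ [])
    (hl : w.getLast? ≠ some none) :
    ∃ C, 0 ≤ C ∧ ∀ a b : ℝ, 0 < a → a ≤ b → b < 1 →
      ‖integralSeries Γ a b w‖ ≤ C * (b / √(1 - b)) := by
  induction w with
  | nil => exact absurd rfl hw
  | cons s w ih =>
    obtain ⟨C, hC, h⟩ : ∃ C, 0 ≤ C ∧ ∀ a t : ℝ, 0 < a → a ≤ t → t < 1 →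
        ‖form s t * integralSeries Γ a t w‖ ≤
          C * ((1 + √(1 - t) ^ 2) / (2 * √(1 - t) ^ 3)) := by
      cases w with
      | nil =>
        refine ⟨2, zero_le_two, fun a t ha hat ht => ?_⟩
        have htm : t ∈ Set.Ioo (0 : ℝ) 1 := ⟨ha.trans_le hat, ht⟩
        rw [integralSeries_nil, mul_one]
        cases s with
        | none => simp at hl
        | some σ =>
          refine (norm_form_some_le σ htm).trans ?_
          have hy := Real.sqrt_pos.2 (sub_pos.2 ht)
          have hy1 : √(1 - t) ≤ 1 := Real.sqrt_le_one.2 (by linarith [htm.1])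
          nth_rewrite 1 [← Real.sq_sqrt (sub_pos.2 ht).le]
          rw [mul_div_assoc', div_le_div_iff₀ (by positivity) (by positivity)]
          have : √(1 - t) ^ 3 ≤ √(1 - t) ^ 2 := pow_le_pow_of_le_one hy.le hy1 (by norm_num)
          nlinarith [pow_pos hy 4]
      | cons r w =>
        obtain ⟨C, hC, h⟩ := ih (List.cons_ne_nil _ _) (by simpa using hl)
        -- The integrand is at most `C (1 - t)^(-3/2)`, which is at most `2 C` times the derivative
        -- of `t / √(1 - t)`.
        refine ⟨2 * C, by positivity, fun a t ha hat ht => ?_⟩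
        have htm : t ∈ Set.Ioo (0 : ℝ) 1 := ⟨ha.trans_le hat, ht⟩
        have ht0 := htm.1
        have ht1 := sub_pos.2 ht
        rw [norm_mul]
        refine (mul_le_mul (norm_form_le s htm) (h a t ha hat ht) (norm_nonneg _)
          (by positivity)).trans ?_
        have hy := Real.sqrt_pos.2 (sub_pos.2 ht)
        have hy2 := Real.sq_sqrt (sub_pos.2 ht).le
        have e : (1 / t + 1 / (1 - t)) * (C * (t / √(1 - t))) = C * (1 / √(1 - t) ^ 3) := by
          have h3 : √(1 - t) ^ 3 = (1 - t) * √(1 - t) := by rw [pow_succ, hy2]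
          rw [h3]
          field_simp
          ring
        rw [e, mul_comm 2 C, _root_.mul_assoc]
        refine mul_le_mul_of_nonneg_left ?_ hC
        rw [mul_div_assoc', div_le_div_iff₀ (by positivity) (by positivity)]
        nlinarith [pow_pos hy 3, pow_pos hy 5]
    refine ⟨C, hC, fun a b ha hab hb => ?_⟩
    have h1 := norm_sub_le_of_norm_deriv_le
      (f := fun t => integralSeries Γ a t (s :: w)) (g := fun t => C * (t / √(1 - t)))
      (fun t ht => hasDerivAt_integralSeries ⟨ha, hab.trans_lt hb⟩ ht (s :: w))
      (fun t ht => (hasDerivAt_div_sqrt ht).const_mul C) ha hab hb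
      (fun t ht ht' => h a t ha ht (ht'.trans hb))
    simp only [integralSeries_self a (List.cons_ne_nil s w), sub_zero] at h1
    refine h1.trans (sub_le_self _ ?_)
    positivity

theorem sqrt_div_mono {a b : ℝ} (hab : a ≤ b) (hb : b < 1) :
    √a / √(1 - a) ≤ √b / √(1 - b) :=
  div_le_div₀ (Real.sqrt_nonneg _) (Real.sqrt_le_sqrt hab) (Real.sqrt_pos.2 (sub_pos.2 hb))
    (Real.sqrt_le_sqrt (by linarith))

/-- The initial value, at `b = a`, for the comparison of two lower endpoints. The factor `a` is
split as `√a * √a` to fit the bound that is propagated. -/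
theorem exists_norm_integralSeries_self_le (w : List (Index Γ)) (hw : w ≠ [])
    (hl : w.getLast? ≠ some none) :
    ∃ C, 0 ≤ C ∧ ∀ a a' : ℝ, 0 < a' → a' ≤ a → a < 1 →
      ‖integralSeries Γ a a w - integralSeries Γ a' a w‖ ≤ C * √a * (√a / √(1 - a)) := by
  obtain ⟨C, hC, h⟩ := exists_norm_integralSeries_le w hw hl
  refine ⟨C, hC, fun a a' ha' haa' ha => ?_⟩
  rw [integralSeries_self a hw, zero_sub, norm_neg]
  refine (h a' a ha' haa' ha).trans_eq ?_
  rw [_root_.mul_assoc, ← mul_div_assoc √a, Real.mul_self_sqrt (ha'.le.trans haa')]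

/-- Of the decay at `0`, one half power is kept as the small factor `√a`, and the other, `√b`, keeps
the next integrand integrable at `0`. -/
theorem exists_norm_integralSeries_sub_le (w : List (Index Γ)) (hl : w.getLast? ≠ some none) :
    ∃ C, 0 ≤ C ∧ ∀ a a' b : ℝ, 0 < a' → a' ≤ a → a ≤ b → b < 1 →
      ‖integralSeries Γ a b w - integralSeries Γ a' b w‖ ≤ C * √a * (√b / √(1 - b)) := by
  induction w with
  | nil =>
    refine ⟨0, le_rfl, fun a a' b _ _ _ _ => ?_⟩
    simp [integralSeries_nil]
  | cons s w ih =>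
    obtain ⟨C₁, hC₁, h₁⟩ := exists_norm_integralSeries_self_le (s :: w) (List.cons_ne_nil _ _) hl
    obtain ⟨C, hC, h⟩ := ih (by cases w <;> simp_all)
    refine ⟨C₁ + 2 * C, by positivity, fun a a' b ha' haa' hab hb => ?_⟩
    have ha : 0 < a := ha'.trans_le haa'
    have ha1 : a < 1 := hab.trans_lt hb
    have h2 := norm_sub_le_of_norm_deriv_le
      (f := fun t => integralSeries Γ a t (s :: w) - integralSeries Γ a' t (s :: w))
      -- The product of `1 / t + 1 / (1 - t)` and `√t / √(1 - t)` is exactly twice the derivative of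
      -- `√t / √(1 - t)`.
      (g := fun t => 2 * (C * √a) * (√t / √(1 - t)))
      (fun t ht => (hasDerivAt_integralSeries ⟨ha, ha1⟩ ht (s :: w)).fun_sub
        (hasDerivAt_integralSeries ⟨ha', haa'.trans_lt ha1⟩ ht (s :: w)))
      (fun t ht => (hasDerivAt_sqrt_div ht).const_mul _) ha hab hb (fun t ht ht' => by
        have htm : t ∈ Set.Ioo (0 : ℝ) 1 := ⟨ha.trans_le ht, ht'.trans hb⟩
        have ht0 := htm.1
        have ht1 := sub_pos.2 htm.2
        simp only [integralSeriesDeriv]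
        rw [← mul_sub, norm_mul]
        refine (mul_le_mul (norm_form_le s htm) (h a a' t ha' haa' ht htm.2) (norm_nonneg _)
          (by positivity)).trans_eq ?_
        have hx := Real.sqrt_pos.2 ht0
        have hy := Real.sqrt_pos.2 ht1
        have h3 : √(1 - t) ^ 3 = (1 - t) * √(1 - t) := by rw [pow_succ, Real.sq_sqrt ht1.le]
        have h4 : t = √t * √t := (Real.mul_self_sqrt ht0.le).symm
        have h5 : 1 / t + 1 / (1 - t) = 1 / (√t * √t * (1 - t)) := by
          rw [← h4]; field_simp; ring
        rw [h3, h5]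
        field_simp)
    have h6 := h₁ a a' ha' haa' ha1
    have h7 : C₁ * √a * (√a / √(1 - a)) ≤ C₁ * √a * (√b / √(1 - b)) :=
      mul_le_mul_of_nonneg_left (sqrt_div_mono hab hb) (by positivity)
    have h8 : 0 ≤ 2 * (C * √a) * (√a / √(1 - a)) := by positivity
    have h9 := norm_le_norm_add_norm_sub' (integralSeries Γ a b (s :: w) -
      integralSeries Γ a' b (s :: w)) (integralSeries Γ a a (s :: w) -
      integralSeries Γ a' a (s :: w))
    calc _ ≤ _ := h9
      _ ≤ C₁ * √a * (√b / √(1 - b)) + 2 * (C * √a) * (√b / √(1 - b)) := by linarith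
      _ = _ := by ring

theorem inv_sqrt_mul_le {t : ℝ} (ht : t ∈ Set.Ioo (0 : ℝ) 1) :
    1 / (√t * √(1 - t)) ≤ 1 / √t + 1 / √(1 - t) := by
  have hx := Real.sqrt_pos.2 ht.1
  have hy := Real.sqrt_pos.2 (sub_pos.2 ht.2)
  rw [div_add_div _ _ hx.ne' hy.ne']
  refine div_le_div_of_nonneg_right ?_ (by positivity)
  nlinarith [Real.sq_sqrt ht.1.le, Real.sq_sqrt (sub_pos.2 ht.2).le]

theorem one_le_inv_sqrt_add {t : ℝ} (ht : t ∈ Set.Ioo (0 : ℝ) 1) :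
    1 / √(1 - t) ≤ 1 / √t + 1 / √(1 - t) ∧ 1 ≤ 1 / √t + 1 / √(1 - t) := by
  have hx := Real.sqrt_pos.2 ht.1
  have hy := Real.sqrt_pos.2 (sub_pos.2 ht.2)
  have h1 : 1 ≤ 1 / √(1 - t) := by
    rw [le_div_iff₀ hy, one_mul]
    exact Real.sqrt_le_one.2 (by linarith [ht.1])
  have h2 : 0 < 1 / √t := one_div_pos.2 hx
  exact ⟨by linarith, by linarith⟩

/-- As the first letter is not `x_1`, the outer form has no pole at `1`, and the singularity `1 /
√(1 - t)` of the inner integral is integrable, uniformly in `a`. -/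
theorem exists_norm_integralSeries_tail_le (w : List (Index Γ)) (hw : IsConvergent w) :
    ∃ C, 0 ≤ C ∧ ∀ a b b' : ℝ, 0 < a → a ≤ b → b ≤ b' → b' < 1 →
      ‖integralSeries Γ a b' w - integralSeries Γ a b w‖ ≤ C * (arcBound b' - arcBound b) := by
  cases w with
  | nil => exact ⟨0, le_rfl, fun a b b' _ _ _ _ => by simp [integralSeries_nil]⟩
  | cons s w =>
    obtain ⟨hs, hl⟩ := hw
    replace hs : s ≠ some 1 := by simpa using hs
    obtain ⟨C, hC, h⟩ : ∃ C, 0 ≤ C ∧ ∀ a t : ℝ, 0 < a → a ≤ t → t < 1 →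
        ‖form s t * integralSeries Γ a t w‖ ≤ C * (1 / √t + 1 / √(1 - t)) := by
      cases w with
      | nil =>
        cases s with
        | none => simp at hl
        | some σ =>
          obtain ⟨C, hC, h⟩ := exists_norm_form_le_of_ne_one (σ := σ) (by simpa using hs)
          refine ⟨C, hC, fun a t ha hat ht => ?_⟩
          have htm : t ∈ Set.Ioo (0 : ℝ) 1 := ⟨ha.trans_le hat, ht⟩
          rw [integralSeries_nil, mul_one]
          exact (h t (Set.Ioo_subset_Icc_self htm)).trans
            (le_mul_of_one_le_right hC (one_le_inv_sqrt_add htm).2)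
      | cons r w =>
        obtain ⟨C₀, hC₀, h₀⟩ := exists_norm_form_le_div hs
        obtain ⟨C, hC, h⟩ := exists_norm_integralSeries_le (r :: w) (List.cons_ne_nil _ _)
          (by simpa using hl)
        refine ⟨C₀ * C, by positivity, fun a t ha hat ht => ?_⟩
        have htm : t ∈ Set.Ioo (0 : ℝ) 1 := ⟨ha.trans_le hat, ht⟩
        have ht0 := htm.1
        rw [norm_mul]
        refine (mul_le_mul (h₀ t htm) (h a t ha hat ht) (norm_nonneg _)
          (by positivity)).trans ?_
        have e : C₀ / t * (C * (t / √(1 - t))) = C₀ * C * (1 / √(1 - t)) := by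
          field_simp
        rw [e]
        exact mul_le_mul_of_nonneg_left (one_le_inv_sqrt_add htm).1 (by positivity)
    refine ⟨C, hC, fun a b b' ha hab hbb' hb' => ?_⟩
    rw [mul_sub]
    exact norm_sub_le_of_norm_deriv_le
      (f := fun t => integralSeries Γ a t (s :: w)) (g := fun t => C * arcBound t)
      (fun t ht => hasDerivAt_integralSeries ⟨ha, hab.trans_lt (hbb'.trans_lt hb')⟩ ht (s :: w))
      (fun t ht => (hasDerivAt_arcBound ht).const_mul C) (ha.trans_le hab) hbb' hb'
      (fun t ht ht' => h a t ha (hab.trans ht) (ht'.trans hb'))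

theorem arcBound_le {t : ℝ} (ht : t ≤ 1) : arcBound t ≤ 2 := by
  have := Real.sqrt_le_one.2 ht
  have := Real.sqrt_nonneg (1 - t)
  rw [arcBound]
  linarith

theorem le_arcBound {t : ℝ} (ht : 0 ≤ t) : -2 ≤ arcBound t := by
  have := Real.sqrt_nonneg t
  have := Real.sqrt_le_one.2 (show 1 - t ≤ 1 by linarith)
  rw [arcBound]
  linarith

theorem exists_norm_integralSeries_head_le (w : List (Index Γ)) (hw : IsConvergent w) :
    ∃ C, 0 ≤ C ∧ ∀ a a' b : ℝ, 0 < a' → a' ≤ a → a ≤ 1 / 2 → a ≤ b → b < 1 →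
      ‖integralSeries Γ a b w - integralSeries Γ a' b w‖ ≤ C * √a := by
  cases w with
  | nil =>
    refine ⟨0, le_rfl, fun a a' b _ _ _ _ _ => ?_⟩
    simp [integralSeries_nil]
  | cons s w =>
    obtain ⟨hs, hl⟩ := hw
    replace hs : s ≠ some 1 := by simpa using hs
    obtain ⟨C₀, hC₀, h₀⟩ := exists_norm_form_le_div hs
    obtain ⟨C₁, hC₁, h₁⟩ := exists_norm_integralSeries_self_le (s :: w) (List.cons_ne_nil _ _) hl
    obtain ⟨C, hC, h⟩ := exists_norm_integralSeries_sub_le w (by cases w <;> simp_all)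
    -- `C₁` bounds the difference at `b = a`, where `a ≤ 1 / 2` gives `√a / √(1 - a) ≤ 1`; the `4`
    -- is the width of `[-2, 2]`, which contains the values of `arcBound` on `[0, 1]`.
    refine ⟨C₁ + C₀ * C * 4, by positivity, fun a a' b ha' haa' ha2 hab hb => ?_⟩
    have ha : 0 < a := ha'.trans_le haa'
    have ha1 : a < 1 := hab.trans_lt hb
    have h2 := norm_sub_le_of_norm_deriv_le
      (f := fun t => integralSeries Γ a t (s :: w) - integralSeries Γ a' t (s :: w))
      (g := fun t => C₀ * (C * √a) * arcBound t)
      (fun t ht => (hasDerivAt_integralSeries ⟨ha, ha1⟩ ht (s :: w)).fun_sub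
        (hasDerivAt_integralSeries ⟨ha', haa'.trans_lt ha1⟩ ht (s :: w)))
      (fun t ht => (hasDerivAt_arcBound ht).const_mul _) ha hab hb (fun t ht ht' => by
        have htm : t ∈ Set.Ioo (0 : ℝ) 1 := ⟨ha.trans_le ht, ht'.trans hb⟩
        have ht0 := htm.1
        have ht1 := sub_pos.2 htm.2
        simp only [integralSeriesDeriv]
        rw [← mul_sub, norm_mul]
        refine (mul_le_mul (h₀ t htm) (h a a' t ha' haa' ht htm.2) (norm_nonneg _)
          (by positivity)).trans ?_
        have hx := Real.sqrt_pos.2 ht0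
        have hy := Real.sqrt_pos.2 ht1
        have e : C₀ / t * (C * √a * (√t / √(1 - t))) =
            C₀ * (C * √a) * (1 / (√t * √(1 - t))) := by
          nth_rewrite 1 [← Real.mul_self_sqrt ht0.le]
          field_simp
        rw [e]
        exact mul_le_mul_of_nonneg_left (inv_sqrt_mul_le htm) (by positivity))
    have h6 := h₁ a a' ha' haa' ha1
    have h7 : √a / √(1 - a) ≤ 1 := div_le_one_of_le₀ (Real.sqrt_le_sqrt (by linarith))
      (Real.sqrt_nonneg _)
    have h8 : C₁ * √a * (√a / √(1 - a)) ≤ C₁ * √a :=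
      mul_le_of_le_one_right (by positivity) h7
    have h9 := norm_le_norm_add_norm_sub' (integralSeries Γ a b (s :: w) -
      integralSeries Γ a' b (s :: w)) (integralSeries Γ a a (s :: w) -
      integralSeries Γ a' a (s :: w))
    have h10 : C₀ * (C * √a) * arcBound b - C₀ * (C * √a) * arcBound a ≤
        C₀ * (C * √a) * 4 := by
      rw [← mul_sub]
      refine mul_le_mul_of_nonneg_left ?_ (by positivity)
      linarith [arcBound_le hb.le, le_arcBound ha.le]
    calc _ ≤ _ := h9
      _ ≤ C₁ * √a + C₀ * (C * √a) * 4 := by linarith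
      _ = _ := by ring

/-- The filter of the pairs `(a, b)` with `a → 0⁺` and `b → 1⁻`. -/
abbrev endpoints : Filter (ℝ × ℝ) := 𝓝[>] 0 ×ˢ 𝓝[<] 1

theorem eventually_endpoints : ∀ᶠ p : ℝ × ℝ in endpoints,
    p.1 ∈ Set.Ioo (0 : ℝ) (1 / 2) ∧ p.2 ∈ Set.Ioo (1 / 2 : ℝ) 1 :=
  prod_mem_prod (Ioo_mem_nhdsGT (by norm_num)) (Ioo_mem_nhdsLT (by norm_num))

theorem exists_tendsto_integralSeries (w : List (Index Γ)) (hw : IsConvergent w) :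
    ∃ z, Tendsto (fun p : ℝ × ℝ => integralSeries Γ p.1 p.2 w) endpoints (𝓝 z) := by
  obtain ⟨C, hC, h⟩ := exists_norm_integralSeries_head_le w hw
  obtain ⟨C', hC', h'⟩ := exists_norm_integralSeries_tail_le w hw
  have hhead : ∀ a a' b : ℝ, 0 < a → 0 < a' → a < 1 / 2 → a' < 1 / 2 → 1 / 2 < b → b < 1 →
      ‖integralSeries Γ a b w - integralSeries Γ a' b w‖ ≤ C * (√a + √a') := by
    intro a a' b ha ha' ha2 ha2' hb hb1
    have e := mul_nonneg hC (Real.sqrt_nonneg a)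
    have e' := mul_nonneg hC (Real.sqrt_nonneg a')
    rw [mul_add]
    rcases le_total a' a with hle | hle
    · exact (h a a' b ha' hle ha2.le (ha2.trans hb).le hb1).trans (by linarith)
    · rw [norm_sub_rev]
      exact (h a' a b ha hle ha2'.le (ha2'.trans hb).le hb1).trans (by linarith)
  have htail : ∀ a b b' : ℝ, 0 < a → a < 1 / 2 → 1 / 2 < b → b < 1 → 1 / 2 < b' → b' < 1 →
      ‖integralSeries Γ a b w - integralSeries Γ a b' w‖ ≤
        C' * ((2 - arcBound b) + (2 - arcBound b')) := by
    intro a b b' ha ha2 hb hb1 hb' hb1'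
    have e := arcBound_le hb1.le
    have e' := arcBound_le hb1'.le
    rcases le_total b' b with hle | hle
    · refine (h' a b' b ha (ha2.trans hb').le hle hb1).trans (mul_le_mul_of_nonneg_left ?_ hC')
      linarith
    · rw [norm_sub_rev]
      refine (h' a b b' ha (ha2.trans hb).le hle hb1').trans (mul_le_mul_of_nonneg_left ?_ hC')
      linarith
  -- Passing through `(a', b)`, the distance between the values at `(a, b)` and `(a', b')` is at
  -- most `g (a, b) + g (a', b')`; `g` tends to `0` since `arcBound 1 = 2`. The Cauchy criterion
  -- then applies.
  let g : ℝ × ℝ → ℝ := fun p => C * √p.1 + C' * (2 - arcBound p.2)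
  have hg : Tendsto g endpoints (𝓝 0) := by
    have h1 : Tendsto (fun p : ℝ × ℝ => p.1) endpoints (𝓝 0) :=
      tendsto_fst.mono_right nhdsWithin_le_nhds
    have h2 : Tendsto (fun p : ℝ × ℝ => p.2) endpoints (𝓝 1) :=
      tendsto_snd.mono_right nhdsWithin_le_nhds
    have hc : Continuous arcBound := by unfold arcBound; fun_prop
    have h3 := ((Real.continuous_sqrt.tendsto 0).comp h1).const_mul C
    have h4 := ((hc.tendsto 1).comp h2).const_sub 2 |>.const_mul C'
    simpa [arcBound, g, endpoints] using h3.add h4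
  refine cauchy_map_iff_exists_tendsto.1 (cauchy_map_iff'.2 ?_)
  rw [tendsto_uniformity_iff_dist_tendsto_zero]
  have hgg : Tendsto (fun q : (ℝ × ℝ) × (ℝ × ℝ) => g q.1 + g q.2) (endpoints ×ˢ endpoints)
      (𝓝 0) := by
    simpa using (hg.comp tendsto_fst).add (hg.comp tendsto_snd)
  refine squeeze_zero' (Eventually.of_forall fun _ => dist_nonneg) ?_ hgg
  filter_upwards [eventually_endpoints.prod_mk eventually_endpoints]
  rintro ⟨⟨a, b⟩, ⟨a', b'⟩⟩ ⟨⟨⟨ha, ha2⟩, hb, hb1⟩, ⟨ha', ha2'⟩, hb', hb1'⟩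
  simp only at ha ha2 hb hb1 ha' ha2' hb' hb1'
  rw [dist_eq_norm]
  refine (norm_sub_le_norm_sub_add_norm_sub _ (integralSeries Γ a' b w) _).trans ?_
  have e1 := hhead a a' b ha ha' ha2 ha2' hb hb1
  have e2 := htail a' b b' ha' ha2' hb hb1 hb' hb1'
  calc _ ≤ _ := add_le_add e1 e2
    _ = _ := by simp only [g]; ring

end RegDist

/-! ### `Li₁` at roots of unity, and the distribution relation on `[a, b]`. -/

namespace RegDist

open NCSeries

variable {Γ : Subgroup ℂˣ}

/-! ### The logarithms `Li₁(σ)` as integrals -/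

theorem form_eq_div {σ : Γ} (t : ℝ) :
    form (some σ) t = ((σ : ℂˣ) : ℂ) / (1 - ((σ : ℂˣ) : ℂ) * t) := by
  have h : ((σ : ℂˣ) : ℂ) ≠ 0 := Units.ne_zero _
  rw [form, ← mul_div_mul_left 1 _ h, mul_one, mul_sub, mul_inv_cancel₀ h]

theorem intervalIntegrable_form [Finite Γ] {σ : Γ} (hσ : σ ≠ 1) {a b : ℝ} (ha : 0 ≤ a)
    (hb : 0 ≤ b) : IntervalIntegrable (form (some σ)) MeasureTheory.volume a b :=
  ((continuousOn_form_of_ne_one hσ).mono (Set.ordConnected_Ici.uIcc_subset ha hb)).intervalIntegrable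

/-- The remainder of the geometric expansion of `σ / (1 - σ t)`, integrated term by term. -/
theorem sub_Li1Partial_eq_integral [Finite Γ] {σ : Γ} (hσ : σ ≠ 1) (N : ℕ) :
    (∫ t in (0 : ℝ)..1, form (some σ) t) - Li1Partial ((σ : ℂˣ) : ℂ) N =
      ∫ t in (0 : ℝ)..1, (((σ : ℂˣ) : ℂ) * t) ^ N * form (some σ) t := by
  set z : ℂ := ((σ : ℂˣ) : ℂ) with hz
  have hint : ∀ N : ℕ, IntervalIntegrable (fun t : ℝ => (z * t) ^ N * form (some σ) t)
      MeasureTheory.volume 0 1 := fun N =>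
    (intervalIntegrable_form hσ le_rfl zero_le_one).continuousOn_mul
      (by fun_prop)
  induction N with
  | zero => simp [Li1Partial]
  | succ N ih =>
    have h1 : Li1Partial z (N + 1) = Li1Partial z N + z ^ (N + 1) / ((N + 1 : ℕ) : ℂ) := by
      rw [Li1Partial, Finset.sum_Icc_succ_top (by omega)]
      rfl
    have h2 : ∫ t in (0 : ℝ)..1, z ^ (N + 1) * (t : ℂ) ^ N = z ^ (N + 1) / ((N + 1 : ℕ) : ℂ) := by
      rw [intervalIntegral.integral_const_mul]
      have h : ∫ t in (0 : ℝ)..1, (t : ℂ) ^ N = ((∫ t in (0 : ℝ)..1, t ^ N : ℝ) : ℂ) := by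
        rw [← intervalIntegral.integral_ofReal]
        simp
      rw [h, integral_pow]
      push_cast
      simp [div_eq_mul_inv]
    rw [h1, ← sub_sub, ih, ← h2, ← intervalIntegral.integral_sub (hint N)]
    · refine intervalIntegral.integral_congr fun t ht => ?_
      rw [Set.uIcc_of_le zero_le_one] at ht
      have hne := inv_sub_ne_zero_of_ne_one hσ ht.1
      have hz0 : z ≠ 0 := Units.ne_zero _
      have h3 : form (some σ) t * (1 - z * t) = z := by
        rw [form_eq_div]
        refine div_mul_cancel₀ _ ?_
        have := mul_ne_zero hz0 hne
        rwa [mul_sub, ← hz, mul_inv_cancel₀ hz0] at this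
      rw [mul_pow, mul_pow]
      linear_combination (z ^ N * (t : ℂ) ^ N) * h3
    · exact Continuous.intervalIntegrable (by fun_prop) _ _

/-- For `σ ≠ 1` the form is bounded on `[0, 1]`, so the remainder is `O(1 / (N + 1))`. -/
theorem tendsto_Li1Partial [Finite Γ] {σ : Γ} (hσ : σ ≠ 1) :
    Tendsto (Li1Partial ((σ : ℂˣ) : ℂ)) atTop (𝓝 (∫ t in (0 : ℝ)..1, form (some σ) t)) := by
  obtain ⟨C, hC, h⟩ := exists_norm_form_le_of_ne_one hσ
  have hlim : Tendsto (fun N : ℕ => C * (1 / ((N : ℝ) + 1))) atTop (𝓝 0) := by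
    simpa using tendsto_one_div_add_atTop_nhds_zero_nat.const_mul C
  rw [tendsto_iff_norm_sub_tendsto_zero]
  refine squeeze_zero (fun _ => norm_nonneg _) (fun N => ?_) hlim
  rw [norm_sub_rev, sub_Li1Partial_eq_integral hσ]
  have hb : ∫ t in (0 : ℝ)..1, C * t ^ N = C * (1 / ((N : ℝ) + 1)) := by
    rw [intervalIntegral.integral_const_mul, integral_pow]
    simp
  rw [← hb]
  refine intervalIntegral.norm_integral_le_of_norm_le zero_le_one
    (MeasureTheory.ae_of_all _ fun t ht => ?_)
    (Continuous.intervalIntegrable (by fun_prop) _ _)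
  rw [norm_mul, norm_pow, norm_mul, norm_eq_one_of_finite, Complex.norm_real,
    Real.norm_of_nonneg ht.1.le, one_mul, mul_comm]
  exact mul_le_mul_of_nonneg_right (h t (Set.Ioc_subset_Icc_self ht)) (pow_nonneg ht.1.le _)

theorem Li1_eq_integral [Finite Γ] {σ : Γ} (hσ : σ ≠ 1) :
    Li1 ((σ : ℂˣ) : ℂ) = ∫ t in (0 : ℝ)..1, form (some σ) t :=
  (tendsto_Li1Partial hσ).limUnder_eq

theorem tendsto_integralSeries_singleton [Finite Γ] {σ : Γ} (hσ : σ ≠ 1) :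
    Tendsto (fun p : ℝ × ℝ => integralSeries Γ p.1 p.2 [some σ]) endpoints
      (𝓝 (Li1 ((σ : ℂˣ) : ℂ))) := by
  rw [Li1_eq_integral hσ]
  have hc := intervalIntegral.continuousOn_primitive_interval'
    (intervalIntegrable_form hσ le_rfl (zero_le_one' ℝ)) Set.left_mem_uIcc
  rw [Set.uIcc_of_le zero_le_one] at hc
  have h0 : Tendsto (fun p : ℝ × ℝ => ∫ t in (0 : ℝ)..p.1, form (some σ) t) endpoints (𝓝 0) := by
    have h := (hc 0 (by simp)).tendsto
    rw [intervalIntegral.integral_same] at h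
    refine h.comp ((tendsto_fst (f := 𝓝[>] (0 : ℝ)) (g := 𝓝[<] (1 : ℝ))).mono_right ?_)
    rw [← nhdsWithin_Ioo_eq_nhdsGT zero_lt_one]
    exact nhdsWithin_mono _ Set.Ioo_subset_Icc_self
  have h1 : Tendsto (fun p : ℝ × ℝ => ∫ t in (0 : ℝ)..p.2, form (some σ) t) endpoints
      (𝓝 (∫ t in (0 : ℝ)..1, form (some σ) t)) := by
    refine (hc 1 (by simp)).tendsto.comp
      ((tendsto_snd (f := 𝓝[>] (0 : ℝ)) (g := 𝓝[<] (1 : ℝ))).mono_right ?_)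
    rw [← nhdsWithin_Ioo_eq_nhdsLT zero_lt_one]
    exact nhdsWithin_mono _ Set.Ioo_subset_Icc_self
  have h := h1.sub h0
  rw [sub_zero] at h
  refine h.congr' (eventually_endpoints.mono fun p hp => ?_)
  have hp2 : 0 ≤ p.2 := by linarith [hp.2.1]
  rw [intervalIntegral.integral_interval_sub_left (intervalIntegrable_form hσ le_rfl hp2)
    (intervalIntegrable_form hσ le_rfl hp.1.1.le)]
  refine Eq.trans ?_ (integralSeries_cons p.1 p.2 (some σ) []).symm
  simp only [integralSeries_nil, mul_one]

/-! ### Roots of unity -/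

theorem card_ker_powMap [Finite Γ] {d : ℕ} (hd : d ∣ Nat.card Γ) :
    Nat.card (powMap Γ d).ker = d := by
  have := isCyclic_subgroup_units Γ
  rw [powMap, MonoidHom.ker_rangeRestrict, IsCyclic.card_powMonoidHom_ker, Nat.gcd_eq_right hd]

theorem powMap_surjective (d : ℕ) : Function.Surjective (powMap Γ d) :=
  MonoidHom.rangeRestrict_surjective _

theorem powMap_eq_iff {d : ℕ} {σ : Γ} {τ : powers Γ d} : powMap Γ d σ = τ ↔ σ ^ d = τ :=
  Subtype.ext_iff

/-- `Γ` is cyclic, so its `d`-torsion has `d` elements, too many to lie in the `j`-torsion, which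
has `gcd(n, j) ≤ j` elements. -/
theorem exists_pow_ne_one [Finite Γ] {d j : ℕ} (hd : d ∣ Nat.card Γ) (hj : 0 < j) (hjd : j < d) :
    ∃ κ : Γ, κ ^ d = 1 ∧ κ ^ j ≠ 1 := by
  have := isCyclic_subgroup_units Γ
  by_contra! h
  have hle : (powMonoidHom d : Γ →* Γ).ker ≤ (powMonoidHom j : Γ →* Γ).ker := fun κ hκ => h κ hκ
  have h1 := Subgroup.card_le_of_le hle
  rw [IsCyclic.card_powMonoidHom_ker, IsCyclic.card_powMonoidHom_ker, Nat.gcd_eq_right hd] at h1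
  have h2 := Nat.gcd_le_right (Nat.card Γ) hj
  omega

open Classical in
theorem sum_fiber_pow [Finite Γ] [Fintype Γ] {d : ℕ} (hd : d ∣ Nat.card Γ) (τ : powers Γ d)
    {j : ℕ} (hj : j < d) :
    ∑ σ : Γ with powMap Γ d σ = τ, (((σ : ℂˣ) : ℂ))⁻¹ ^ j = if j = 0 then (d : ℂ) else 0 := by
  split_ifs with h
  · subst h
    simp only [pow_zero, Finset.sum_const, nsmul_eq_mul, mul_one, Nat.cast_inj]
    refine Eq.trans ?_ (card_ker_powMap hd)
    rw [← Nat.card_congr (MonoidHom.fiberEquivKerOfSurjective (powMap_surjective d) τ),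
      Nat.card_eq_fintype_card, Fintype.card_ofFinset]
    congr
  · obtain ⟨κ, hκ, hκj⟩ := exists_pow_ne_one hd (Nat.pos_of_ne_zero h) hj
    have hne : (((κ : ℂˣ) : ℂ))⁻¹ ^ j ≠ 1 := by
      intro h1
      rw [inv_pow, inv_eq_one] at h1
      exact hκj (Subtype.ext (Units.ext (by simpa using h1)))
    -- Translation by `κ⁻¹` permutes the fibre and multiplies the sum by a scalar different from
    -- `1`.
    have hs : ∑ σ : Γ with powMap Γ d σ = τ, (((σ : ℂˣ) : ℂ))⁻¹ ^ j =
        (((κ : ℂˣ) : ℂ))⁻¹ ^ j * ∑ σ : Γ with powMap Γ d σ = τ, (((σ : ℂˣ) : ℂ))⁻¹ ^ j := by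
      rw [Finset.mul_sum]
      refine Finset.sum_equiv (Equiv.mulLeft κ⁻¹) (fun σ => ?_) fun σ _ => ?_
      · simp [powMap_eq_iff, mul_pow, hκ]
      · rw [← mul_pow, ← mul_inv]
        simp
    refine (mul_eq_zero.1 (?_ : ((((κ : ℂˣ) : ℂ))⁻¹ ^ j - 1) * _ = 0)).resolve_left
      (sub_ne_zero.2 hne)
    linear_combination -hs

open Classical in
/-- The pullback of the form `ω_τ` under `t ↦ t^d`. -/
theorem sum_fiber_form [Finite Γ] [Fintype Γ] {d : ℕ} (hd : d ∣ Nat.card Γ) (τ : powers Γ d)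
    {t : ℝ} (ht : t ∈ Set.Ioo (0 : ℝ) 1) :
    ∑ σ : Γ with powMap Γ d σ = τ, form (some σ) t =
      (d * (t : ℂ) ^ (d - 1)) * form (some (τ : Γ)) (t ^ d) := by
  have hd0 : 0 < d := Nat.pos_of_dvd_of_pos hd Nat.card_pos
  have htd : t ^ d ∈ Set.Ioo (0 : ℝ) 1 := ⟨pow_pos ht.1 d, pow_lt_one₀ ht.1.le ht.2 hd0.ne'⟩
  have hne := inv_sub_ne_zero (τ : Γ) htd
  -- With `u = σ⁻¹`, this is `1 / (u - t) = ∑ uⁱ t^(d-1-i) / (u ^ d - t ^ d)`. Summed over the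
  -- fibre, only `i = 0` survives.
  have h1 : ∀ σ : Γ, powMap Γ d σ = τ → form (some σ) t =
      ∑ i ∈ Finset.range d, (((σ : ℂˣ) : ℂ))⁻¹ ^ i *
        ((t : ℂ) ^ (d - 1 - i) * form (some (τ : Γ)) (t ^ d)) := by
    intro σ hσ
    have h2 := (Commute.all (((σ : ℂˣ) : ℂ))⁻¹ (t : ℂ)).geom_sum₂_mul d
    have h3 : (((σ : ℂˣ) : ℂ))⁻¹ ^ d = ((((τ : Γ) : ℂˣ) : ℂ))⁻¹ := by
      rw [← powMap_eq_iff.1 hσ]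
      simp
    rw [h3] at h2
    simp only [← _root_.mul_assoc]
    rw [← Finset.sum_mul, form, form, div_eq_iff (inv_sub_ne_zero σ ht), mul_one_div,
      div_mul_eq_mul_div, h2, Complex.ofReal_pow, div_self]
    rwa [Complex.ofReal_pow] at hne
  rw [Finset.sum_congr rfl fun σ hσ => h1 σ (Finset.mem_filter.1 hσ).2, Finset.sum_comm,
    Finset.sum_eq_single 0]
  · rw [← Finset.sum_mul, sum_fiber_pow hd τ hd0, if_pos rfl, Nat.sub_zero, _root_.mul_assoc]
  · intro i hi hi0
    rw [← Finset.sum_mul, sum_fiber_pow hd τ (Finset.mem_range.1 hi), if_neg hi0, zero_mul]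
  · intro h
    exact absurd (Finset.mem_range.2 hd0) h

/-! ### The distribution relation on `[a, b]` -/

theorem sum_pushLetter_none [Fintype Γ] {d : ℕ} (hd : d ∣ Nat.card Γ) (φ : Index Γ → ℂ) :
    ∑ s, pushLetter (powMap Γ d) s none * φ s = d * φ none := by
  rw [Fintype.sum_option]
  simp only [pushLetter, card_ker_powMap hd, zero_mul, Finset.sum_const_zero, add_zero]

open Classical in
theorem sum_pushLetter_some [Fintype Γ] {d : ℕ} (τ : powers Γ d) (φ : Index Γ → ℂ) :
    ∑ s, pushLetter (powMap Γ d) s (some τ) * φ s =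
      ∑ σ : Γ with powMap Γ d σ = τ, φ (some σ) := by
  rw [Fintype.sum_option, Finset.sum_filter]
  simp [pushLetter]

theorem sum_pullLetter [Fintype Γ] {d : ℕ} (τ : Index (powers Γ d)) (φ : Index Γ → ℂ) :
    ∑ s, pullLetter (powIncl Γ d) s τ * φ s = φ (τ.map (powIncl Γ d)) := by
  rw [Fintype.sum_option]
  cases τ <;> simp [pullLetter]

theorem substitute_smul {A B : Type*} [Finite A] (θ : A → B → ℂ) (c : ℂ) (F : NCSeries A)
    (v : List B) : substitute θ (c • F) v = c * substitute θ F v := by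
  cases nonempty_fintype A
  simp only [substitute_apply, smul_apply, Finset.mul_sum, _root_.mul_assoc]

/-- The relation on single letters. For `x_0` the factor `|ker p^d| = d` is the one in `d(t ^ d) / t
^ d = d · dt / t`. -/
theorem sum_pushLetter_form [Finite Γ] [Fintype Γ] {d : ℕ} (hd : d ∣ Nat.card Γ)
    (τ : Index (powers Γ d)) {t : ℝ} (ht : t ∈ Set.Ioo (0 : ℝ) 1) :
    ∑ s, pushLetter (powMap Γ d) s τ * form s t =
      (d * (t : ℂ) ^ (d - 1)) * ∑ s, pullLetter (powIncl Γ d) s τ * form s (t ^ d) := by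
  have hd0 : 0 < d := Nat.pos_of_dvd_of_pos hd Nat.card_pos
  rw [sum_pullLetter]
  cases τ with
  | none =>
    rw [sum_pushLetter_none hd]
    have ht0 : (t : ℂ) ≠ 0 := by exact_mod_cast ht.1.ne'
    obtain ⟨e, rfl⟩ : ∃ e, d = e + 1 := ⟨d - 1, by omega⟩
    simp only [form, Option.map_none, Nat.add_sub_cancel]
    push_cast
    rw [pow_succ]
    field_simp
  | some τ => rw [sum_pushLetter_some, sum_fiber_form hd τ ht]; rfl

/-- By induction on the word, both sides have the same derivative in `b`, by the relation on letters
and the chain rule for `t ↦ t ^ d`; they vanish at `b = a` for nonempty words. -/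
theorem pushforward_integralSeries [Finite Γ] {d : ℕ} (hd : d ∣ Nat.card Γ) {a b : ℝ}
    (ha : a ∈ Set.Ioo (0 : ℝ) 1) (hb : b ∈ Set.Ioo (0 : ℝ) 1) :
    pushforward (powMap Γ d) (integralSeries Γ a b) =
      pullback (powIncl Γ d) (integralSeries Γ (a ^ d) (b ^ d)) := by
  cases nonempty_fintype Γ
  have hd0 : 0 < d := Nat.pos_of_dvd_of_pos hd Nat.card_pos
  have hpow : ∀ t ∈ Set.Ioo (0 : ℝ) 1, t ^ d ∈ Set.Ioo (0 : ℝ) 1 := fun t ht =>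
    ⟨pow_pos ht.1 d, pow_lt_one₀ ht.1.le ht.2 hd0.ne'⟩
  funext v
  induction v generalizing b with
  | nil => simp only [pushforward, pullback, substitute_nil, integralSeries_nil]
  | cons τ v ih =>
    have hz : ∀ (c : ℝ) (θ : Index Γ → Index (powers Γ d) → ℂ),
        substitute θ (integralSeries Γ c c) (τ :: v) = 0 := by
      intro c θ
      rw [substitute_cons]
      refine Finset.sum_eq_zero fun s _ => ?_
      have h : lderiv s (integralSeries Γ c c) = (0 : ℂ) • lderiv s (integralSeries Γ c c) := by
        funext w
        rw [smul_apply, zero_mul]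
        exact integralSeries_self c (List.cons_ne_nil s w)
      rw [h, substitute_smul, zero_mul, mul_zero]
    refine eq_of_hasDerivAt_Ioo
      (f := fun t => pushforward (powMap Γ d) (integralSeries Γ a t) (τ :: v))
      (g := fun t => pullback (powIncl Γ d) (integralSeries Γ (a ^ d) (t ^ d)) (τ :: v))
      (fun t ht => hasDerivAt_substitute _ (fun w => hasDerivAt_integralSeries ha ht w) _)
      (fun t ht => ?_) ha hb ((hz a _).trans (hz (a ^ d) _).symm)
    have h1 : ∀ w, HasDerivAt (fun s : ℝ => integralSeries Γ (a ^ d) (s ^ d) w)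
        (((d * (t : ℂ) ^ (d - 1)) • integralSeriesDeriv Γ (a ^ d) (t ^ d)) w) t := by
      intro w
      refine ((hasDerivAt_integralSeries (hpow a ha) (hpow t ht) w).scomp t
        (hasDerivAt_pow d t)).congr_deriv ?_
      rw [smul_apply, Complex.real_smul]
      push_cast
      rfl
    refine (hasDerivAt_substitute (pullLetter (powIncl Γ d)) h1 (τ :: v)).congr_deriv ?_
    rw [substitute_smul, substitute_cons, substitute_cons]
    simp only [lderiv_integralSeriesDeriv, substitute_smul, ← _root_.mul_assoc]
    rw [← Finset.sum_mul, ← Finset.sum_mul, sum_pushLetter_form hd τ ht]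
    have h2 := ih ht
    simp only [pushforward, pullback] at h2
    rw [h2]
    ring

theorem integralSeries_pow_none [Finite Γ] {d : ℕ} (hd : d ∣ Nat.card Γ) {a b : ℝ}
    (ha : a ∈ Set.Ioo (0 : ℝ) 1) (hb : b ∈ Set.Ioo (0 : ℝ) 1) :
    integralSeries Γ (a ^ d) (b ^ d) [none] = d * integralSeries Γ a b [none] := by
  cases nonempty_fintype Γ
  have h := congrFun (pushforward_integralSeries hd ha hb) [none]
  simp only [pushforward, pullback, substitute_cons, substitute_nil, lderiv_apply] at h
  rw [sum_pushLetter_none hd fun s => integralSeries Γ a b [s],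
    sum_pullLetter none fun s => integralSeries Γ (a ^ d) (b ^ d) [s]] at h
  exact h.symm

-- The coefficient at `x_1` of the relation on `[a, b]`: the divergent terms with `σ = 1` cancel,
-- leaving integrals that tend to values of `Li₁`.
open Classical in
theorem integralSeries_pow_one [Finite Γ] [Fintype Γ] {d : ℕ} (hd : d ∣ Nat.card Γ) {a b : ℝ}
    (ha : a ∈ Set.Ioo (0 : ℝ) 1) (hb : b ∈ Set.Ioo (0 : ℝ) 1) :
    integralSeries Γ (a ^ d) (b ^ d) [some 1] - integralSeries Γ a b [some 1] =
      ∑ σ : Γ with σ ^ d = 1 ∧ σ ≠ 1, integralSeries Γ a b [some σ] := by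
  have h := congrFun (pushforward_integralSeries hd ha hb) [some 1]
  simp only [pushforward, pullback, substitute_cons, substitute_nil, lderiv_apply] at h
  rw [sum_pushLetter_some 1 fun s => integralSeries Γ a b [s],
    sum_pullLetter (some 1) fun s => integralSeries Γ (a ^ d) (b ^ d) [s]] at h
  have h1 : ∀ σ : Γ, powMap Γ d σ = 1 ↔ σ ^ d = 1 := fun σ => powMap_eq_iff
  simp only [h1, Option.map_some, map_one] at h
  rw [← h, ← Finset.filter_filter, Finset.filter_ne', sub_eq_iff_eq_add,
    Finset.sum_erase_add _ _ (by simp)]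

end RegDist

/-! ### Passage to the limit. -/

namespace RegDist

open NCSeries

variable {Γ : Subgroup ℂˣ}

/-! ### The regularised series as a limit -/

/-- The regularised series of the iterated integrals on `[a, b]`. -/
noncomputable def regSeries (Γ : Subgroup ℂˣ) (a b : ℝ) : NCSeries (Index Γ) :=
  regularise (some 1) none (integralSeries Γ a b)

/-- The group-like series in which `x_1` and `x_0` have the coefficient zero. -/
def normalised (Γ : Subgroup ℂˣ) : Set (NCSeries (Index Γ)) :=
  {F | IsGroupLike F ∧ F [some 1] = 0 ∧ F [none] = 0}

theorem eventually_mem_Ioo : ∀ᶠ p : ℝ × ℝ in endpoints,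
    p.1 ∈ Set.Ioo (0 : ℝ) 1 ∧ p.2 ∈ Set.Ioo (0 : ℝ) 1 :=
  eventually_endpoints.mono fun _ h =>
    ⟨⟨h.1.1, by linarith [h.1.2]⟩, ⟨by linarith [h.2.1], h.2.2⟩⟩

theorem eventually_regSeries_mem [Finite Γ] :
    ∀ᶠ p : ℝ × ℝ in endpoints, regSeries Γ p.1 p.2 ∈ normalised Γ :=
  eventually_mem_Ioo.mono fun _ hp =>
    ⟨regularise_isGroupLike _ _ (isGroupLike_integralSeries hp.1 hp.2),
      regularise_left (by simp) rfl, regularise_right (by simp) rfl⟩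

theorem regSeries_apply (a b : ℝ) {w : List (Index Γ)} (hw : IsConvergent w) :
    regSeries Γ a b w = iteratedIntegral a w b :=
  regularise_apply _ _ _ hw.1 hw.2

theorem reducible_convergent [Finite Γ] (w : List (Index Γ)) :
    Reducible (normalised Γ) IsConvergent fun F => F w :=
  reducible_of_isGroupLike (by simp) w

/-- Every series satisfying the characterisation is the limit of `regSeries`, whence uniqueness. -/
theorem IsRegularisedSeries.tendsto [Finite Γ] {I : NCSeries (Index Γ)}
    (hI : IsRegularisedSeries Γ I) (w : List (Index Γ)) :
    Tendsto (fun p : ℝ × ℝ => regSeries Γ p.1 p.2 w) endpoints (𝓝 (I w)) := by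
  refine (reducible_convergent w).tendsto eventually_regSeries_mem
    ⟨hI.groupLike, hI.coeff_x1, hI.coeff_x0⟩ fun u hu => ?_
  simp only [regSeries_apply _ _ hu]
  exact hI.convergent u hu

theorem existsUnique_regularisedSeries (Γ : Subgroup ℂˣ) [Finite Γ] :
    ∃! I : NCSeries (Index Γ), IsRegularisedSeries Γ I := by
  have hlim : ∀ w : List (Index Γ),
      ∃ z, Tendsto (fun p : ℝ × ℝ => regSeries Γ p.1 p.2 w) endpoints (𝓝 z) := fun w =>
    (reducible_convergent w).exists_tendsto eventually_regSeries_mem fun u hu => by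
      simp only [regSeries_apply _ _ hu]
      exact exists_tendsto_integralSeries u hu
  choose I hI using hlim
  refine ⟨I, ⟨?_, ?_, ?_, ?_⟩, fun J hJ => ?_⟩
  · exact IsGroupLike.of_tendsto (eventually_regSeries_mem.mono fun _ h => h.1) hI
  · intro w hw
    simpa only [regSeries_apply _ _ hw] using hI w
  · exact tendsto_nhds_unique (hI _) (tendsto_const_nhds.congr'
      (eventually_regSeries_mem.mono fun _ h => h.2.2.symm))
  · exact tendsto_nhds_unique (hI _) (tendsto_const_nhds.congr'
      (eventually_regSeries_mem.mono fun _ h => h.2.1.symm))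
  · exact funext fun w => tendsto_nhds_unique (hJ.tendsto w) (hI w)

/-! ### The distribution relation -/

/-- The `x_0` factors of the two sides agree, because both the variable `x_0` under `p^d_*` and its
coefficient under `t ↦ t ^ d` are multiplied by `d`. The `x_1` factors, which stand on the left,
combine into the remaining exponential. -/
theorem pushforward_regSeries [Finite Γ] {d : ℕ} (hd : d ∣ Nat.card Γ) {a b : ℝ}
    (ha : a ∈ Set.Ioo (0 : ℝ) 1) (hb : b ∈ Set.Ioo (0 : ℝ) 1) :
    pushforward (powMap Γ d) (regSeries Γ a b) =
      exp ((integralSeries Γ (a ^ d) (b ^ d) [some 1] - integralSeries Γ a b [some 1]) •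
          x (some (1 : powers Γ d))) *
        pullback (powIncl Γ d) (regSeries Γ (a ^ d) (b ^ d)) := by
  have h1 : ∀ c : ℂ, substitute (pushLetter (powMap Γ d)) (exp (c • x (some 1))) =
      exp (c • x (some 1)) := fun c => by
    rw [substitute_exp_smul_x (z := 1) (b := some 1), mul_one]
    · simp [pushLetter]
    · rintro (_ | τ) h
      · rfl
      · simpa [pushLetter, eq_comm] using h
  have h2 : ∀ c : ℂ, substitute (pullLetter (powIncl Γ d)) (exp (c • x (some 1))) =
      exp (c • x (some 1)) := fun c => by
    rw [substitute_exp_smul_x (z := 1) (b := some 1), mul_one]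
    · simp [pullLetter]
    · rintro (_ | τ) h
      · rfl
      · simpa [pullLetter, powIncl] using h
  have h3 : ∀ c : ℂ, substitute (pushLetter (powMap Γ d)) (exp (c • x none)) =
      exp ((c * d) • x none) := fun c => by
    rw [substitute_exp_smul_x (z := d) (b := none)]
    · rw [pushLetter, card_ker_powMap hd]
    · rintro (_ | τ) h
      · exact absurd rfl h
      · rfl
  have h4 : ∀ c : ℂ, substitute (pullLetter (powIncl Γ d)) (exp (c • x none)) =
      exp (c • x none) := fun c => by
    rw [substitute_exp_smul_x (z := 1) (b := none), mul_one]
    · rfl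
    · rintro (_ | τ) h
      · exact absurd rfl h
      · rfl
  have h5 := pushforward_integralSeries hd ha hb
  rw [pushforward, pullback] at h5
  rw [pushforward, pullback, regSeries, regSeries, regularise, regularise, substitute_mul,
    substitute_mul, substitute_mul, substitute_mul, h1, h2, h3, h4, h5,
    integralSeries_pow_none hd ha hb, ← NCSeries.mul_assoc (exp (_ • _)) (exp (_ • _)), exp_smul_x_mul]
  congr 5
  · ring
  · ring

theorem tendsto_pow_endpoints {d : ℕ} (hd : d ≠ 0) :
    Tendsto (fun p : ℝ × ℝ => (p.1 ^ d, p.2 ^ d)) endpoints endpoints := by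
  refine Tendsto.prodMk ?_ ?_
  · refine tendsto_nhdsWithin_iff.2 ⟨?_, eventually_mem_Ioo.mono fun p hp => pow_pos hp.1.1 d⟩
    have h : Tendsto (fun p : ℝ × ℝ => p.1) endpoints (𝓝 0) :=
      tendsto_fst.mono_right nhdsWithin_le_nhds
    simpa [hd] using h.pow d
  · refine tendsto_nhdsWithin_iff.2
      ⟨?_, eventually_mem_Ioo.mono fun p hp => pow_lt_one₀ hp.2.1.le hp.2.2 hd⟩
    have h : Tendsto (fun p : ℝ × ℝ => p.2) endpoints (𝓝 1) :=
      tendsto_snd.mono_right nhdsWithin_le_nhds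
    simpa using h.pow d

theorem IsRegularisedSeries.pushforward_eq [Finite Γ] {I : NCSeries (Index Γ)}
    (hI : IsRegularisedSeries Γ I) {d : ℕ} (hd : d ∣ Nat.card Γ) :
    pushforward (powMap Γ d) I =
      exp ((∑ᶠ (σ : Γ) (_ : σ ^ d = 1 ∧ σ ≠ 1), Li1 ((σ : ℂˣ) : ℂ)) •
          x (some (1 : powers Γ d))) *
        pullback (powIncl Γ d) I := by
  classical
  cases nonempty_fintype Γ
  have hd0 : d ≠ 0 := (Nat.pos_of_dvd_of_pos hd Nat.card_pos).ne'
  rw [finsum_cond_eq_sum_of_cond_iff (t := Finset.univ.filter fun σ : Γ => σ ^ d = 1 ∧ σ ≠ 1)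
    _ (by simp)]
  funext v
  have hl := tendsto_substitute (pushLetter (powMap Γ d)) hI.tendsto v
  -- Since `(a ^ d, b ^ d)` also tends to `(0⁺, 1⁻)`, the series on `[a ^ d, b ^ d]` has the same
  -- limit `I`.
  have hr := tendsto_substitute (pullLetter (powIncl Γ d))
    fun w => (hI.tendsto w).comp (tendsto_pow_endpoints hd0)
  have hc : Tendsto (fun p : ℝ × ℝ => integralSeries Γ (p.1 ^ d) (p.2 ^ d) [some 1] -
      integralSeries Γ p.1 p.2 [some 1]) endpoints
      (𝓝 (∑ σ : Γ with σ ^ d = 1 ∧ σ ≠ 1, Li1 ((σ : ℂˣ) : ℂ))) :=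
    (tendsto_finsetSum _ fun σ hσ => tendsto_integralSeries_singleton
      (Finset.mem_filter.1 hσ).2.2).congr' (eventually_mem_Ioo.mono fun p hp =>
        (integralSeries_pow_one hd hp.1 hp.2).symm)
  refine tendsto_nhds_unique hl ((tendsto_mul (tendsto_exp_smul_x hc _) hr v).congr'
    (eventually_mem_Ioo.mono fun p hp => ?_))
  exact (congrFun (pushforward_regSeries hd hp.1 hp.2) v).symm

end RegDist

theorem mainTheorem6 (Γ : Subgroup ℂˣ) [Finite Γ] :
    (∃! I : RegDist.NCSeries (RegDist.Index Γ), RegDist.IsRegularisedSeries Γ I) ∧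
    (∀ σ : Γ, σ ≠ 1 →
      Tendsto (RegDist.Li1Partial ((σ : ℂˣ) : ℂ)) atTop (𝓝 (RegDist.Li1 ((σ : ℂˣ) : ℂ)))) ∧
    ∀ I : RegDist.NCSeries (RegDist.Index Γ), RegDist.IsRegularisedSeries Γ I →
      ∀ d : ℕ, d ∣ Nat.card Γ →
        RegDist.pushforward (RegDist.powMap Γ d) I =
          RegDist.NCSeries.exp
              ((∑ᶠ (σ : Γ) (_ : σ ^ d = 1 ∧ σ ≠ 1), RegDist.Li1 ((σ : ℂˣ) : ℂ)) •
                RegDist.NCSeries.x (some (1 : RegDist.powers Γ d))) *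
            RegDist.pullback (RegDist.powIncl Γ d) I :=
  ⟨RegDist.existsUnique_regularisedSeries Γ,
    fun _ hσ => tendsto_nhds_limUnder ⟨_, RegDist.tendsto_Li1Partial hσ⟩,
    fun _ hI _ hd => hI.pushforward_eq hd⟩
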